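/- Let $d\in\mathbb N$, $T>0$, and let $\nu$ be a probability measure on $\mathbb R^d\setminus\{0\}$. Let $X=(X_t)_{0\le t\le T}$ be a Poisson process on $\mathbb R^d$ with intensity $\nu$, i.e. $X$ has càdlàg paths, $X_0=0$ a.s., independent increments, and for $0\le s\le t\le T$ the increment $X_t-X_s$ has the compound Poisson law $\sum_{n\ge0}e^{-(t-s)}\frac{(t-s)^n}{n!}\,\nu^{*n}$. Let $M_T$ be the space of càdlàg paths $\omega:[0,T]\to\mathbb R^d$ with the $\sigma$-algebra generated by the coordinate maps (the Borel $\sigma$-algebra of the Skorokhod topology), and let $\mu$ be the law of $X$ on $M_T$. Write $\mu(F)=\int F\,d\mu$ and put $$\mathscr E(F,G)=\frac1T\int_{M_T}\mu(d\omega)\int_0^T dt\int_{\mathbb R^d}\big(F(\omega+x1_{[t,T]})-F(\omega)\big)\big(G(\omega+x1_{[t,T]})-G(\omega)\big)\,\nu(dx),$$ $$\mathscr D(\mathscr E)=\{F\in L^2(M_T;\mu):\ \mathscr E(F,F)<\infty\}.$$ Then: 1. $\mathscr E$ is well defined on $\mathscr D(\mathscr E)$: the values $\mathscr E(F,F)\in[0,\infty]$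 and $\mathscr E(F,G)$ do not depend on the $\mu$-versions of $F$ and $G$, and for $F,G\in\mathscr D(\mathscr E)$ the integral defining $\mathscr E(F,G)$ converges absolutely. 2. $(\mathscr E,\mathscr D(\mathscr E))$ is a symmetric Dirichlet form on $L^2(M_T;\mu)$ (a densely defined, nonnegative, symmetric, closed, Markovian bilinear form), and it is conservative: $1\in\mathscr D(\mathscr E)$, $\mathscr E(1,F)=0$ for all $F\in\mathscr D(\mathscr E)$, and the associated semigroup $(P_t)_{t\ge0}$ on $L^2(M_T;\mu)$ satisfies $P_t1=1$ for all $t\ge 0$. 3. The Poincaré inequality $$\mu(F^2)\le T\,\mathscr E(F,F)+\mu(F)^2,\qquad F\in\mathscr D(\mathscr E),$$ holds. 4. For no constant $C>0$ does the log-Sobolev inequality $$\mu(F^2\log F^2)\le C\,\mathscr E(F,F),\qquad F\in\mathscr D(\mathscr E),\ \mu(F^2)=1,$$ hold (with $0\log 0=0$). -/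

import Mathlib

open MeasureTheory ProbabilityTheory Filter Topology
open scoped NNReal ENNReal

/-! ### Symmetric Dirichlet forms on an `L²` space -/

section DirichletForm

variable {α : Type*} [MeasurableSpace α] {μ : Measure α}

/-- `(𝓔, D)` is a symmetric Dirichlet form on `L²(μ)`: a nonnegative, symmetric, bilinear form on a
dense linear subspace `D` of `L²(μ)` which is closed (that is, `D` is complete for the inner
product `𝓔(u, v) + ⟨u, v⟩`) and Markovian (the unit contraction `u ↦ (u ∨ 0) ∧ 1` operates).
Only the values of `𝓔` on `D × D` matter. -/
structure IsSymmetricDirichletForm (D : Set (Lp ℝ 2 μ)) (𝓔 : Lp ℝ 2 μ → Lp ℝ 2 μ → ℝ) :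
    Prop where
  zero_mem : 0 ∈ D
  add_mem : ∀ u ∈ D, ∀ v ∈ D, u + v ∈ D
  smul_mem : ∀ c : ℝ, ∀ u ∈ D, c • u ∈ D
  dense : Dense D
  symm : ∀ u ∈ D, ∀ v ∈ D, 𝓔 u v = 𝓔 v u
  add_left : ∀ u ∈ D, ∀ v ∈ D, ∀ w ∈ D, 𝓔 (u + v) w = 𝓔 u w + 𝓔 v w
  smul_left : ∀ c : ℝ, ∀ u ∈ D, ∀ v ∈ D, 𝓔 (c • u) v = c * 𝓔 u v
  nonneg : ∀ u ∈ D, 0 ≤ 𝓔 u u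
  complete : ∀ u : ℕ → Lp ℝ 2 μ, (∀ n, u n ∈ D) →
    (∀ ε > 0, ∃ N, ∀ m ≥ N, ∀ n ≥ N, 𝓔 (u m - u n) (u m - u n) + ‖u m - u n‖ ^ 2 < ε) →
    ∃ v ∈ D, Tendsto (fun n => 𝓔 (u n - v) (u n - v) + ‖u n - v‖ ^ 2) atTop (𝓝 0)
  markov : ∀ u ∈ D, ∀ v : Lp ℝ 2 μ, (∀ᵐ a ∂μ, v a = min (max (u a) 0) 1) →
    v ∈ D ∧ 𝓔 v v ≤ 𝓔 u u

/-- `P` is the semigroup associated with the form `(𝓔, D)`: a strongly continuous contraction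
semigroup on `L²(μ)` whose generator `L` is the generator of the form, i.e. `L u = f` if and only
if `u ∈ D` and `𝓔(u, v) = -⟨f, v⟩` for all `v ∈ D`. -/
structure IsAssociatedSemigroup (D : Set (Lp ℝ 2 μ)) (𝓔 : Lp ℝ 2 μ → Lp ℝ 2 μ → ℝ)
    (P : ℝ≥0 → Lp ℝ 2 μ →L[ℝ] Lp ℝ 2 μ) : Prop where
  zero : ∀ u, P 0 u = u
  add : ∀ s t u, P (s + t) u = P s (P t u)
  contraction : ∀ t u, ‖P t u‖ ≤ ‖u‖
  continuous : ∀ u, Tendsto (fun t => P t u) (𝓝 0) (𝓝 u)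
  generator : ∀ u f : Lp ℝ 2 μ,
    Tendsto (fun t : ℝ≥0 => (t : ℝ)⁻¹ • (P t u - u)) (𝓝[>] 0) (𝓝 f) ↔
      u ∈ D ∧ ∀ v ∈ D, 𝓔 u v = -inner ℝ f v

/-- Conservativeness of a form over a finite measure: the constant function `1` belongs to the
domain of the form, it is annihilated by the form, and the semigroup associated with the form
preserves it. -/
structure IsConservative [IsFiniteMeasure μ] (D : Set (Lp ℝ 2 μ))
    (𝓔 : Lp ℝ 2 μ → Lp ℝ 2 μ → ℝ) : Prop where
  one_mem : Lp.const 2 μ (1 : ℝ) ∈ D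
  form_one : ∀ v ∈ D, 𝓔 (Lp.const 2 μ (1 : ℝ)) v = 0
  semigroup_one : ∀ P : ℝ≥0 → Lp ℝ 2 μ →L[ℝ] Lp ℝ 2 μ, IsAssociatedSemigroup D 𝓔 P →
    ∀ t, P t (Lp.const 2 μ (1 : ℝ)) = Lp.const 2 μ (1 : ℝ)

end DirichletForm

/-! ### The path space -/

/-- Right continuous paths on `[0, T]` with left limits. -/
def IsCadlag {T : ℝ} {d : ℕ} (ω : Set.Icc (0 : ℝ) T → EuclideanSpace ℝ (Fin d)) : Prop :=
  ∀ t, ContinuousWithinAt ω (Set.Ici t) t ∧ ∃ l, Tendsto ω (𝓝[<] t) (𝓝 l)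

/-- The space `M_T` of càdlàg paths `[0, T] → ℝ^d`. -/
def CadlagPath (T : ℝ) (d : ℕ) : Type :=
  {ω : Set.Icc (0 : ℝ) T → EuclideanSpace ℝ (Fin d) // IsCadlag ω}

namespace CadlagPath

variable {T : ℝ} {d : ℕ}

instance : CoeFun (CadlagPath T d) (fun _ => Set.Icc (0 : ℝ) T → EuclideanSpace ℝ (Fin d)) :=
  ⟨Subtype.val⟩

/-- The σ-algebra generated by the coordinate maps `ω ↦ ω t`
(it is also the Borel σ-algebra of the Skorokhod topology). -/
instance : MeasurableSpace (CadlagPath T d) :=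
  MeasurableSpace.comap Subtype.val MeasurableSpace.pi

/-- The path `ω + x 1_{[t,T]}`. -/
noncomputable def addJump (ω : CadlagPath T d) (t : ℝ) (x : EuclideanSpace ℝ (Fin d)) :
    CadlagPath T d :=
  ⟨fun s => ω s + (Set.Icc t T).indicator (fun _ => x) (s : ℝ), by
    intro s
    obtain ⟨hr, l, hl⟩ := ω.2 s
    by_cases h : t < (s : ℝ)
    · have hev : ∀ᶠ r : Set.Icc (0 : ℝ) T in 𝓝 s,
          (Set.Icc t T).indicator (fun _ => x) (r : ℝ) = x := by
        filter_upwards [continuous_subtype_val.continuousAt.eventually (lt_mem_nhds h)] with r hr'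
        exact Set.indicator_of_mem (show (r : ℝ) ∈ Set.Icc t T from ⟨le_of_lt hr', r.2.2⟩) _
      refine ⟨hr.add ?_, l + x, hl.add ?_⟩
      · exact (continuousAt_const.congr
          (hev.mono fun r hr' => hr'.symm)).continuousWithinAt
      · exact (tendsto_const_nhds.congr' (hev.mono fun r hr' => hr'.symm)).mono_left
          nhdsWithin_le_nhds
    · refine ⟨hr.add ?_, l + 0, hl.add ?_⟩
      · rcases eq_or_lt_of_le (not_lt.1 h) with h' | h'
        · refine (continuousWithinAt_const (b := x)).congr ?_ ?_
          · intro r hr'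
            exact Set.indicator_of_mem (show (r : ℝ) ∈ Set.Icc t T from
              ⟨h'.symm.le.trans (show (s : ℝ) ≤ r from hr'), r.2.2⟩) _
          · exact Set.indicator_of_mem (show (s : ℝ) ∈ Set.Icc t T from ⟨h'.ge, s.2.2⟩) _
        · have hev : ∀ᶠ r : Set.Icc (0 : ℝ) T in 𝓝 s,
              (Set.Icc t T).indicator (fun _ => x) (r : ℝ) = 0 := by
            filter_upwards [continuous_subtype_val.continuousAt.eventually (gt_mem_nhds h')]
              with r hr'
            exact Set.indicator_of_notMem (fun hm => absurd hm.1 (not_le.2 hr')) _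
          exact (continuousAt_const.congr
            (hev.mono fun r hr' => hr'.symm)).continuousWithinAt
      · refine tendsto_const_nhds.congr' ?_
        filter_upwards [self_mem_nhdsWithin] with r hr'
        refine (Set.indicator_of_notMem (fun hm => ?_) _).symm
        exact absurd (lt_of_le_of_lt hm.1 (show (r : ℝ) < s from hr')) h⟩

end CadlagPath

/-! ### The Poisson process with intensity `ν` -/

section Poisson

variable {d : ℕ}

/-- The `n`-fold convolution power of `ν`. -/
noncomputable def convPower (ν : Measure (EuclideanSpace ℝ (Fin d))) :
    ℕ → Measure (EuclideanSpace ℝ (Fin d))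
  | 0 => Measure.dirac 0
  | n + 1 => (convPower ν n).conv ν

/-- The compound Poisson distribution `∑ₙ e^{-r} rⁿ / n! ν^{*n}` with rate `r` and jump law `ν`. -/
noncomputable def compoundPoisson (r : ℝ≥0) (ν : Measure (EuclideanSpace ℝ (Fin d))) :
    Measure (EuclideanSpace ℝ (Fin d)) :=
  Measure.sum fun n => poissonMeasure r {n} • convPower ν n

/-- `X = (X_t)_{0 ≤ t ≤ T}` is a Poisson process with intensity `ν` on `ℝ^d` (for a probability
measure `ν`: a compound Poisson process with jump rate `1` and jump law `ν`), realized with càdlàg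
paths: it starts from `0`, has independent increments, and `X_t - X_s` has the compound Poisson
distribution with rate `t - s` and jump law `ν`. -/
structure IsPoissonProcess {T : ℝ} (ν : Measure (EuclideanSpace ℝ (Fin d)))
    {Ω : Type*} [MeasurableSpace Ω] (P : Measure Ω) (X : Ω → CadlagPath T d) : Prop where
  start : ∀ t : Set.Icc (0 : ℝ) T, (t : ℝ) = 0 → ∀ᵐ a ∂P, X a t = 0
  indep : HasIndepIncrements (fun (t : Set.Icc (0 : ℝ) T) (a : Ω) => X a t) P
  increments : ∀ s t : Set.Icc (0 : ℝ) T, s ≤ t →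
    HasLaw (fun a => X a t - X a s) (compoundPoisson ((t : ℝ) - s).toNNReal ν) P

end Poisson

/-! ### The jump-type form on the path space -/

section JumpForm

variable {T : ℝ} {d : ℕ}

/-- `Γ_{t,x}(F, G)(ω) = (F(ω + x 1_{[t,T]}) - F(ω)) (G(ω + x 1_{[t,T]}) - G(ω))`. -/
noncomputable def jumpGamma (t : ℝ) (x : EuclideanSpace ℝ (Fin d)) (F G : CadlagPath T d → ℝ)
    (ω : CadlagPath T d) : ℝ :=
  (F (ω.addJump t x) - F ω) * (G (ω.addJump t x) - G ω)

/-- `𝓔(F, G) = T⁻¹ ∫ μ(dω) ∫_0^T dt ∫ ν(dx) Γ_{t,x}(F, G)(ω)`. -/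
noncomputable def jumpForm (ν : Measure (EuclideanSpace ℝ (Fin d))) (μ : Measure (CadlagPath T d))
    (F G : CadlagPath T d → ℝ) : ℝ :=
  T⁻¹ * ∫ ω, (∫ t in Set.Icc 0 T, (∫ x, jumpGamma t x F G ω ∂ν)) ∂μ

/-- The diagonal value `𝓔(F, F)` as an element of `[0, ∞]`, defined for every `F`
since `Γ_{t,x}(F, F) ≥ 0`. -/
noncomputable def jumpEnergy (ν : Measure (EuclideanSpace ℝ (Fin d)))
    (μ : Measure (CadlagPath T d)) (F : CadlagPath T d → ℝ) : ℝ≥0∞ :=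
  ENNReal.ofReal T⁻¹ *
    ∫⁻ ω, (∫⁻ t in Set.Icc 0 T, (∫⁻ x, ENNReal.ofReal (jumpGamma t x F F ω) ∂ν)) ∂μ

/-- The domain `{F ∈ L²(M_T; μ) : 𝓔(F, F) < ∞}`. -/
def jumpDomain (ν : Measure (EuclideanSpace ℝ (Fin d))) (μ : Measure (CadlagPath T d)) :
    Set (Lp ℝ 2 μ) :=
  {F | jumpEnergy ν μ F < ⊤}

end JumpForm

/-! The path law is itself compound Poisson. Càdlàg paths form a commutative monoid under addition,
and `μ` is the law of a sum of a Poisson(`T`) number of independent one-jump paths `x 1_{[t,T]}`,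
with `t` uniform on `[0,T]` and `x` of law `ν` (`CadlagPath.law_eq_compoundPoissonLaw`). Indeed a
path law is determined by its start and its increments. A character of the increments is
multiplicative in the path, so its mean is `exp (T (∫ f dρ - 1))`, where `ρ` is the one-jump law. A
single jump falls into at most one of the disjoint time intervals, so the exponent is a sum over
intervals and the mean factors.

Every jump count has positive Poisson weight, hence `μ ∗ ρ ≪ μ`: adding a random jump does not
charge null sets. Therefore `D F (ω, t, x) = F (ω + x 1_{[t,T]}) - F ω` is well defined on classes,
and the form is `T⁻¹ ‖D F‖²` in `L²`. Quasi-invariance makes `D` closed, which gives completeness;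
the Markov property holds because the unit contraction is 1-Lipschitz. Since `D 1 = 0`, the
generator kills `1` and the semigroup fixes it.

For the Poincaré inequality, take two copies of the compound Poisson sum that share a Poisson(`s r`)
number of jumps and have Poisson(`(1 - s) r`) many private ones each. The expectation of the product
of the values of `F` at the two copies goes from `(E F)²` at `s = 0` to `E F²` at `s = 1`. Its
derivative is `r` times the expected product of the two averaged increments, which by `2ab ≤ a² +
b²` and Jensen is at most `r E (D F)²`. Only the counts `(k, m, m')` of shared and private jumps
evolve, so the interpolation is an exponential of shifts on bounded functions on `ℕ³`
(`BoundedFun.poisson_interpolation`).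

Log-Sobolev fails on the event that the path has moved by a small time `h`. Its probability `p` is
of order `h`, and only jumps before `h` affect it. The normalized indicator thus has bounded energy,
while its entropy `log p⁻¹` is unbounded. -/

/-! ### Compound Poisson laws on commutative monoids -/

section CompoundPoissonLaw

variable {M : Type*} [AddCommMonoid M] [MeasurableSpace M]

/-- The `n`-fold convolution power of a measure on an additive monoid. -/
noncomputable def addConvPow (ρ : Measure M) : ℕ → Measure M
  | 0 => Measure.dirac 0
  | n + 1 => (addConvPow ρ n).conv ρ

/-- The compound Poisson distribution with rate `r` and jump law `ρ` on an additive monoid. -/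
noncomputable def compoundPoissonLaw (r : ℝ≥0) (ρ : Measure M) : Measure M :=
  Measure.sum fun n => poissonMeasure r {n} • addConvPow ρ n

lemma convPower_eq_addConvPow {d : ℕ} (ν : Measure (EuclideanSpace ℝ (Fin d))) (n : ℕ) :
    convPower ν n = addConvPow ν n := by
  induction n with
  | zero => rfl
  | succ n ih => simp only [convPower, addConvPow, ih]

lemma compoundPoisson_eq_compoundPoissonLaw {d : ℕ} (r : ℝ≥0)
    (ν : Measure (EuclideanSpace ℝ (Fin d))) :
    compoundPoisson r ν = compoundPoissonLaw r ν := by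
  simp only [compoundPoisson, compoundPoissonLaw, convPower_eq_addConvPow]

variable [MeasurableAdd₂ M] {ρ : Measure M} [IsProbabilityMeasure ρ]

instance isProbabilityMeasure_addConvPow (n : ℕ) : IsProbabilityMeasure (addConvPow ρ n) := by
  induction n with
  | zero => exact Measure.dirac.isProbabilityMeasure
  | succ n ih => exact Measure.probabilitymeasure_of_probabilitymeasures_conv _ _

instance isProbabilityMeasure_compoundPoissonLaw (r : ℝ≥0) :
    IsProbabilityMeasure (compoundPoissonLaw r ρ) := by
  constructor
  rw [compoundPoissonLaw, Measure.sum_apply _ MeasurableSet.univ]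
  simp only [Measure.smul_apply, measure_univ, smul_eq_mul, mul_one]
  have h := measure_iUnion (μ := poissonMeasure r) (f := fun n : ℕ => ({n} : Set ℕ))
    (fun i j hij => by simpa using hij) (fun _ => MeasurableSet.singleton _)
  rw [← h, Set.iUnion_of_singleton, measure_univ]

lemma integral_compoundPoissonLaw {E : Type*} [NormedAddCommGroup E] [NormedSpace ℝ E]
    [CompleteSpace E] (r : ℝ≥0) {f : M → E}
    (hf : AEStronglyMeasurable f (compoundPoissonLaw r ρ)) {K : ℝ} (hK : ∀ x, ‖f x‖ ≤ K) :
    ∫ x, f x ∂(compoundPoissonLaw r ρ)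
      = ∫ n, (∫ x, f x ∂(addConvPow ρ n)) ∂(poissonMeasure r) := by
  have hi : Integrable f (compoundPoissonLaw r ρ) :=
    Integrable.of_bound hf K (Eventually.of_forall hK)
  have h1 := hasSum_integral_measure (hi : Integrable f (Measure.sum _))
  have hi2 : Integrable (fun n => ∫ x, f x ∂(addConvPow ρ n)) (poissonMeasure r) := by
    refine Integrable.of_bound .of_discrete K (Eventually.of_forall fun n => ?_)
    simpa using norm_integral_le_of_norm_le_const (μ := addConvPow ρ n)
      (Eventually.of_forall hK)
  have h2 := hasSum_integral_poissonMeasure hi2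
  refine h1.unique ?_
  convert! h2 using 2 with n
  rw [integral_smul_measure, poissonMeasure_singleton, ENNReal.toReal_ofReal (by positivity)]

/-- The integral of a bounded multiplicative function. -/
lemma integral_addConvPow_of_mul {f : M → ℂ} (hf : Measurable f) {K : ℝ} (hK : ∀ x, ‖f x‖ ≤ K)
    (h0 : f 0 = 1) (hmul : ∀ x y, f (x + y) = f x * f y) (n : ℕ) :
    ∫ x, f x ∂(addConvPow ρ n) = (∫ x, f x ∂ρ) ^ n := by
  induction n with
  | zero => simp [addConvPow, integral_dirac' _ _ hf.stronglyMeasurable, h0]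
  | succ n ih =>
    rw [addConvPow, integral_conv
      (Integrable.of_bound hf.aestronglyMeasurable K (Eventually.of_forall hK))]
    simp only [hmul, integral_const_mul, integral_mul_const, ih, pow_succ]

/-- Given `n` jumps the mean is the `n`-th power of the one-jump mean, and the Poisson generating
function sums these powers. It is applied below to characters, both on `ℝ^d` and on path space. -/
lemma integral_compoundPoissonLaw_of_mul (r : ℝ≥0) {f : M → ℂ} (hf : Measurable f) {K : ℝ}
    (hK : ∀ x, ‖f x‖ ≤ K) (h0 : f 0 = 1) (hmul : ∀ x y, f (x + y) = f x * f y) :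
    ∫ x, f x ∂(compoundPoissonLaw r ρ) = Complex.exp (r * (∫ x, f x ∂ρ - 1)) := by
  rw [integral_compoundPoissonLaw r hf.aestronglyMeasurable hK]
  simp only [integral_addConvPow_of_mul hf hK h0 hmul]
  have hi2 : Integrable (fun n => (∫ x, f x ∂ρ) ^ n) (poissonMeasure r) := by
    refine Integrable.of_bound .of_discrete K (Eventually.of_forall fun n => ?_)
    rw [← integral_addConvPow_of_mul hf hK h0 hmul]
    simpa using norm_integral_le_of_norm_le_const (μ := addConvPow ρ n)
      (Eventually.of_forall hK)
  refine (hasSum_integral_poissonMeasure hi2).unique ?_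
  have h := (NormedSpace.expSeries_div_hasSum_exp ((r : ℂ) * ∫ x, f x ∂ρ)).mul_left
    (Complex.exp (-r))
  rw [← Complex.exp_eq_exp_ℂ, ← Complex.exp_add] at h
  convert! h using 1
  · funext n
    rw [Complex.real_smul]
    push_cast
    rw [mul_pow]
    ring
  · congr 1
    ring

/-- For `r > 0` all Poisson weights are positive, so a null set is null for every convolution power;
convolving with `ρ` only raises the power by one. For `r = 0` the law is a point mass and this
breaks down. -/
lemma conv_compoundPoissonLaw_absolutelyContinuous {r : ℝ≥0} (hr : 0 < r) :
    (compoundPoissonLaw r ρ).conv ρ ≪ compoundPoissonLaw r ρ := by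
  refine Measure.AbsolutelyContinuous.mk fun s hs h => ?_
  rw [compoundPoissonLaw, Measure.sum_apply _ hs, ENNReal.tsum_eq_zero] at h
  have hn : ∀ n, addConvPow ρ n s = 0 := by
    intro n
    have := h n
    rw [Measure.smul_apply, smul_eq_mul, mul_eq_zero] at this
    refine this.resolve_left ?_
    rw [poissonMeasure_singleton, ENNReal.ofReal_eq_zero, not_le]
    positivity
  rw [← lintegral_indicator_one hs, Measure.lintegral_conv (by fun_prop (disch := exact hs)),
    compoundPoissonLaw, lintegral_sum_measure, ENNReal.tsum_eq_zero]
  intro n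
  rw [lintegral_smul_measure, ← Measure.lintegral_conv (by fun_prop (disch := exact hs)),
    lintegral_indicator_one hs, ← addConvPow, hn, smul_zero]

end CompoundPoissonLaw

/-! ### Exponentials of shifts -/

section Shift

/-- Bounded real functions on a discrete monoid. -/
def BoundedFun (G : Type*) [TopologicalSpace G] : Type _ := BoundedContinuousFunction G ℝ

namespace BoundedFun

section Basic

variable {G : Type*} [TopologicalSpace G]

noncomputable instance : NormedAddCommGroup (BoundedFun G) :=
  inferInstanceAs (NormedAddCommGroup (BoundedContinuousFunction G ℝ))

noncomputable instance : NormedSpace ℝ (BoundedFun G) :=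
  inferInstanceAs (NormedSpace ℝ (BoundedContinuousFunction G ℝ))

instance : CompleteSpace (BoundedFun G) :=
  inferInstanceAs (CompleteSpace (BoundedContinuousFunction G ℝ))

instance : FunLike (BoundedFun G) G ℝ :=
  inferInstanceAs (FunLike (BoundedContinuousFunction G ℝ) G ℝ)

@[simp] lemma add_apply (f g : BoundedFun G) (x : G) : (f + g) x = f x + g x := rfl

@[simp] lemma sub_apply (f g : BoundedFun G) (x : G) : (f - g) x = f x - g x := rfl

@[simp] lemma smul_apply (c : ℝ) (f : BoundedFun G) (x : G) : (c • f) x = c * f x := rfl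

lemma abs_apply_le_norm (f : BoundedFun G) (x : G) : |f x| ≤ ‖f‖ :=
  BoundedContinuousFunction.norm_coe_le_norm (f : BoundedContinuousFunction G ℝ) x

/-- Evaluation at a point. -/
noncomputable def eval (x : G) : BoundedFun G →L[ℝ] ℝ :=
  LinearMap.mkContinuous
    { toFun := fun f => f x
      map_add' := fun _ _ => rfl
      map_smul' := fun _ _ => rfl } 1
    (fun f => by
      rw [one_mul]
      exact f.abs_apply_le_norm x)

lemma hasSum_exp_apply (Z : BoundedFun G →L[ℝ] BoundedFun G) (f : BoundedFun G) (x : G) :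
    HasSum (fun n : ℕ => ((n.factorial : ℝ)⁻¹) * (Z ^ n) f x) (NormedSpace.exp Z f x) := by
  have h := NormedSpace.exp_series_hasSum_exp' (𝕂 := ℝ) Z
  exact (h.mapL (ContinuousLinearMap.apply ℝ (BoundedFun G) f)).mapL (eval x)

/-- All terms of the exponential series preserve positivity. A negative multiple of the identity in
the generator is split off beforehand by `exp_add_smul_one`. -/
lemma exp_apply_nonneg {Z : BoundedFun G →L[ℝ] BoundedFun G}
    (hZ : ∀ f : BoundedFun G, (∀ x, 0 ≤ f x) → ∀ x, 0 ≤ Z f x) {f : BoundedFun G}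
    (hf : ∀ x, 0 ≤ f x) (x : G) : 0 ≤ NormedSpace.exp Z f x := by
  have hpow : ∀ n x, 0 ≤ (Z ^ n) f x := by
    intro n
    induction n with
    | zero => simpa using hf
    | succ n ih =>
      rw [pow_succ']
      exact hZ _ ih
  exact (hasSum_exp_apply Z f x).nonneg fun n => mul_nonneg (by positivity) (hpow n x)

lemma exp_add_smul_one (Z : BoundedFun G →L[ℝ] BoundedFun G) (c : ℝ) :
    NormedSpace.exp (Z + c • 1) = Real.exp c • NormedSpace.exp Z := by
  let _ : NormedAlgebra ℚ (BoundedFun G →L[ℝ] BoundedFun G) := .restrictScalars ℚ ℝ _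
  have hc : Commute Z (c • 1) := (Commute.one_right Z).smul_right c
  rw [NormedSpace.exp_add_of_commute hc, ← Algebra.algebraMap_eq_smul_one,
    ← NormedSpace.algebraMap_exp_comm, ← Real.exp_eq_exp_ℝ, Algebra.algebraMap_eq_smul_one,
    mul_smul_comm, mul_one]

variable [DiscreteTopology G]

/-- A bounded function as an element of `BoundedFun G`. -/
def mk (f : G → ℝ) (K : ℝ) (hK : ∀ x, |f x| ≤ K) : BoundedFun G :=
  BoundedContinuousFunction.ofNormedAddCommGroup f continuous_of_discreteTopology K hK

@[simp] lemma mk_apply (f : G → ℝ) (K : ℝ) (hK : ∀ x, |f x| ≤ K) (x : G) : mk f K hK x = f x := rfl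

end Basic

variable {G : Type*} [AddCommMonoid G] [TopologicalSpace G] [DiscreteTopology G]

/-- The shift by `v` on bounded functions. -/
noncomputable def shift (v : G) : BoundedFun G →L[ℝ] BoundedFun G :=
  LinearMap.mkContinuous
    { toFun := fun f => mk (fun x => f (x + v)) ‖f‖ fun x => f.abs_apply_le_norm _
      map_add' := fun _ _ => rfl
      map_smul' := fun _ _ => rfl } 1
    (fun f => by
      rw [one_mul]
      exact (BoundedContinuousFunction.norm_le (norm_nonneg _)).2 fun x => f.abs_apply_le_norm _)

@[simp] lemma shift_apply (v : G) (f : BoundedFun G) (x : G) : shift v f x = f (x + v) := rfl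

lemma shift_comm (v w : G) : Commute (shift v) (shift w) := by
  refine ContinuousLinearMap.ext fun f => DFunLike.ext _ _ fun x => ?_
  change f (x + v + w) = f (x + w + v)
  rw [add_right_comm]

lemma shift_pow_apply (v : G) (n : ℕ) (f : BoundedFun G) (x : G) :
    (shift v ^ n) f x = f (x + n • v) := by
  induction n generalizing x with
  | zero => simp
  | succ n ih =>
    rw [pow_succ', mul_apply_eq_comp, shift_apply, ih, succ_nsmul', add_assoc]

/-- The expansion `e^{-r} ∑ rⁿ/n! S_vⁿ` of the exponential is the average over a Poisson(`r`) number
of steps `v`. -/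
lemma exp_smul_shift_sub_one_apply (r : ℝ≥0) (v : G) (f : BoundedFun G) (x : G) :
    NormedSpace.exp ((r : ℝ) • (shift v - 1)) f x = ∫ n : ℕ, f (x + n • v) ∂(poissonMeasure r) := by
  have hi : Integrable (fun n : ℕ => f (x + n • v)) (poissonMeasure r) :=
    Integrable.of_bound .of_discrete ‖f‖ (Eventually.of_forall fun n => f.abs_apply_le_norm _)
  have h1 : (r : ℝ) • (shift v - 1) = (r : ℝ) • shift v + (-(r : ℝ)) • 1 := by
    rw [smul_sub, neg_smul, sub_eq_add_neg]
  rw [h1, exp_add_smul_one]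
  refine HasSum.unique ?_ (hasSum_integral_poissonMeasure hi)
  convert! (hasSum_exp_apply ((r : ℝ) • shift v) f x).mul_left (Real.exp (-r)) using 2 with n
  rw [smul_pow, _root_.smul_apply, smul_apply, shift_pow_apply]
  simp only [smul_eq_mul]
  ring

end BoundedFun

end Shift

/-! ### Interpolation between shared and independent Poisson counts. -/

section PoissonInterpolation

namespace BoundedFun

/-- The generator of the interpolation between a Poisson number of shared points and a Poisson
number of independently resampled points. -/
noncomputable def interpGen : BoundedFun (ℕ × ℕ × ℕ) →L[ℝ] BoundedFun (ℕ × ℕ × ℕ) :=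
  shift (1, 0, 0) - shift (0, 1, 0) - shift (0, 0, 1) + 1

/-- The generator of the resampled points. -/
noncomputable def resampleGen : BoundedFun (ℕ × ℕ × ℕ) →L[ℝ] BoundedFun (ℕ × ℕ × ℕ) :=
  (shift (0, 1, 0) - 1) + (shift (0, 0, 1) - 1)

lemma interpGen_apply (A : BoundedFun (ℕ × ℕ × ℕ)) (k m m' : ℕ) :
    interpGen A (k, m, m') =
      A (k + 1, m, m') - A (k, m + 1, m') - A (k, m, m' + 1) + A (k, m, m') := rfl

lemma interpGen_add_resampleGen : interpGen + resampleGen = shift (1, 0, 0) - 1 := by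
  rw [interpGen, resampleGen]; abel

lemma commute_interpGen_resampleGen : Commute interpGen resampleGen := by
  have h1 : ∀ v : ℕ × ℕ × ℕ, Commute interpGen (shift v) := fun v =>
    (((shift_comm _ _).sub_left (shift_comm _ _)).sub_left (shift_comm _ _)).add_left
      (Commute.one_left _)
  exact ((h1 _).sub_right (Commute.one_right _)).add_right
    ((h1 _).sub_right (Commute.one_right _))

/-- The interpolation with a fraction `s` of shared points, at total rate `r`. -/
noncomputable def interp (r s : ℝ) : BoundedFun (ℕ × ℕ × ℕ) →L[ℝ] BoundedFun (ℕ × ℕ × ℕ) :=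
  NormedSpace.exp (s • (r • interpGen)) * NormedSpace.exp (r • resampleGen)

lemma interp_eq_exp (r s : ℝ) :
    interp r s = NormedSpace.exp (s • (r • interpGen) + r • resampleGen) := by
  let _ : NormedAlgebra ℚ (BoundedFun (ℕ × ℕ × ℕ) →L[ℝ] BoundedFun (ℕ × ℕ × ℕ)) :=
    .restrictScalars ℚ ℝ _
  rw [interp, NormedSpace.exp_add_of_commute]
  exact ((commute_interpGen_resampleGen.smul_left _).smul_left _).smul_right _

lemma interp_nonneg {r s : ℝ} (hr : 0 ≤ r) (hs0 : 0 ≤ s) (hs1 : s ≤ 1)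
    {f : BoundedFun (ℕ × ℕ × ℕ)} (hf : ∀ x, 0 ≤ f x) (x : ℕ × ℕ × ℕ) : 0 ≤ interp r s f x := by
  -- The exponent is that of independent counts, shared at rate `s r` and private at rate `(1 - s)
  -- r` each; apart from the scalar part it is positive exactly because `0 ≤ s ≤ 1`.
  have hW : s • (r • interpGen) + r • resampleGen =
      ((s * r) • shift (1, 0, 0) + (r * (1 - s)) • shift (0, 1, 0)
        + (r * (1 - s)) • shift (0, 0, 1)) + (s * r - 2 * r) • 1 := by
    rw [interpGen, resampleGen]
    module
  rw [interp_eq_exp, hW, exp_add_smul_one, _root_.smul_apply, smul_apply]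
  refine mul_nonneg (Real.exp_nonneg _) (exp_apply_nonneg (fun g hg y => ?_) hf x)
  have hs : 0 ≤ r * (1 - s) := mul_nonneg hr (by linarith)
  exact add_nonneg (add_nonneg (mul_nonneg (mul_nonneg hs0 hr) (hg _)) (mul_nonneg hs (hg _)))
    (mul_nonneg hs (hg _))

lemma hasDerivAt_interp (r s : ℝ) (f : BoundedFun (ℕ × ℕ × ℕ)) (x : ℕ × ℕ × ℕ) :
    HasDerivAt (fun s => interp r s f x) (r * interp r s (interpGen f) x) s := by
  have h := hasDerivAt_exp_smul_const (r • interpGen) s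
  have h2 := (((eval x).comp (ContinuousLinearMap.apply ℝ (BoundedFun (ℕ × ℕ × ℕ))
    (NormedSpace.exp (r • resampleGen) f))).hasFDerivAt.comp_hasDerivAt s h)
  refine h2.congr_deriv ?_
  -- Differentiation leaves the generator between the two exponentials; commuting it past the second
  -- lets it act on `f` directly.
  have hc : Commute (r • interpGen) (NormedSpace.exp (r • resampleGen)) := by
    let _ : NormedAlgebra ℚ (BoundedFun (ℕ × ℕ × ℕ) →L[ℝ] BoundedFun (ℕ × ℕ × ℕ)) :=
      .restrictScalars ℚ ℝ _
    exact ((commute_interpGen_resampleGen.smul_left _).smul_right _).exp_right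
  change ((NormedSpace.exp (s • (r • interpGen)) * (r • interpGen)) *
    NormedSpace.exp (r • resampleGen)) f x = _
  rw [mul_assoc, hc.eq, ← mul_assoc]
  change (interp r s) (r • interpGen f) x = _
  rw [map_smul, smul_apply]

/-- At `s = 1` every jump is shared. -/
lemma interp_one_apply (r : ℝ≥0) (f : BoundedFun (ℕ × ℕ × ℕ)) :
    interp r 1 f (0, 0, 0) = ∫ n, f (n, 0, 0) ∂(poissonMeasure r) := by
  rw [interp_eq_exp, one_smul, ← smul_add, interpGen_add_resampleGen, exp_smul_shift_sub_one_apply]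
  simp

/-- At `s = 0` no jump is shared and the two private counts are independent. -/
lemma interp_zero_apply (r : ℝ≥0) (f : BoundedFun (ℕ × ℕ × ℕ)) :
    interp r 0 f (0, 0, 0) =
      ∫ m, (∫ m', f (0, m, m') ∂(poissonMeasure r)) ∂(poissonMeasure r) := by
  let _ : NormedAlgebra ℚ (BoundedFun (ℕ × ℕ × ℕ) →L[ℝ] BoundedFun (ℕ × ℕ × ℕ)) :=
    .restrictScalars ℚ ℝ _
  rw [interp_eq_exp, zero_smul, zero_add, resampleGen, smul_add, NormedSpace.exp_add_of_commute,
    mul_apply_eq_comp, exp_smul_shift_sub_one_apply]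
  · simp [exp_smul_shift_sub_one_apply]
  · refine Commute.smul_left (Commute.smul_right ?_ _) _
    exact ((shift_comm _ _).sub_left (Commute.one_left _)).sub_right (Commute.one_right _)

/-- A differential inequality for the interpolation between two Poisson averages. -/
theorem poisson_interpolation (r : ℝ≥0) (A : BoundedFun (ℕ × ℕ × ℕ)) (b : BoundedFun ℕ)
    (h : ∀ k m m', A (k + 1, m, m') - A (k, m + 1, m') - A (k, m, m' + 1) + A (k, m, m')
      ≤ (b (k + m) + b (k + m')) / 2) :
    ∫ n, A (n, 0, 0) ∂(poissonMeasure r)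
        - ∫ m, (∫ m', A (0, m, m') ∂(poissonMeasure r)) ∂(poissonMeasure r)
      ≤ r * ∫ n, b n ∂(poissonMeasure r) := by
  -- The upper bound as a function of the counts. It sees only the totals `k + m` and `k + m'` of
  -- the two copies, one at a time.
  let C : BoundedFun (ℕ × ℕ × ℕ) :=
    mk (fun p => (b (p.1 + p.2.1) + b (p.1 + p.2.2)) / 2) ‖b‖ fun p => by
      have h1 := abs_le.1 (b.abs_apply_le_norm (p.1 + p.2.1))
      have h2 := abs_le.1 (b.abs_apply_le_norm (p.1 + p.2.2))
      rw [abs_le]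
      constructor <;> linarith
  -- Each copy keeps a Poisson(`r`) total for every `s`, so such a function has a constant mean
  -- along the interpolation.
  have hC : interpGen C = 0 := by
    refine DFunLike.ext _ _ fun ⟨k, m, m'⟩ => ?_
    rw [interpGen_apply]
    change (b (k + 1 + m) + b (k + 1 + m')) / 2 - (b (k + (m + 1)) + b (k + m')) / 2
      - (b (k + m) + b (k + (m' + 1))) / 2 + (b (k + m) + b (k + m')) / 2 = 0
    rw [show k + 1 + m = k + (m + 1) by ring, show k + 1 + m' = k + (m' + 1) by ring]
    ring
  have hconst : ∀ s, interp r s C (0, 0, 0) = interp r 1 C (0, 0, 0) := by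
    have hd : ∀ s, HasDerivAt (fun s => interp r s C (0, 0, 0)) 0 s := by
      intro s
      have := hasDerivAt_interp r s C (0, 0, 0)
      rw [hC, map_zero] at this
      exact this.congr_deriv (mul_zero _)
    exact fun s => is_const_of_deriv_eq_zero (fun s => (hd s).differentiableAt)
      (fun s => (hd s).deriv) s 1
  have hC1 : interp r 1 C (0, 0, 0) = ∫ n, b n ∂(poissonMeasure r) := by
    rw [interp_one_apply]
    simp [C]
  -- Subtracting the linear function with the claimed slope turns the estimate into monotonicity on
  -- `[0,1]`.
  have hder : ∀ s, HasDerivAt (fun s => interp r s A (0, 0, 0) - s * (r * interp r 1 C (0, 0, 0)))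
      (r * interp r s (interpGen A) (0, 0, 0) - 1 * (r * interp r 1 C (0, 0, 0))) s := fun s =>
    (hasDerivAt_interp r s A (0, 0, 0)).sub ((hasDerivAt_id s).mul_const _)
  have hanti := antitoneOn_of_deriv_nonpos (convex_Icc (0 : ℝ) 1)
    (fun s _ => (hder s).continuousAt.continuousWithinAt)
    (fun s _ => (hder s).differentiableAt.differentiableWithinAt) (fun s hs => by
      rw [interior_Icc] at hs
      rw [(hder s).deriv, ← hconst s, one_mul, ← mul_sub]
      refine mul_nonpos_of_nonneg_of_nonpos r.2 ?_
      have := interp_nonneg r.2 hs.1.le hs.2.le (f := C - interpGen A) (fun ⟨k, m, m'⟩ => by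
        rw [sub_apply, interpGen_apply, sub_nonneg]
        exact h k m m') (0, 0, 0)
      rw [map_sub, sub_apply] at this
      exact sub_nonpos.2 (sub_nonneg.1 this))
  have := hanti (Set.left_mem_Icc.2 zero_le_one) (Set.right_mem_Icc.2 zero_le_one) zero_le_one
  simp only [zero_mul, one_mul, sub_zero] at this
  rw [hC1, interp_one_apply, interp_zero_apply] at this
  linarith

end BoundedFun

end PoissonInterpolation

/-! ### The Poincaré inequality for compound Poisson laws on a monoid. -/

section CompoundPoissonPoincare

lemma integrable_of_abs_le {α : Type*} [MeasurableSpace α] {μ : Measure α} [IsFiniteMeasure μ]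
    {f : α → ℝ} (hf : Measurable f) {K : ℝ} (hK : ∀ x, |f x| ≤ K) : Integrable f μ :=
  Integrable.of_bound hf.aestronglyMeasurable K (Eventually.of_forall hK)

lemma abs_integral_le_of_abs_le {α : Type*} [MeasurableSpace α] {μ : Measure α}
    [IsProbabilityMeasure μ] {f : α → ℝ} {K : ℝ} (hK : ∀ x, |f x| ≤ K) : |∫ x, f x ∂μ| ≤ K := by
  simpa using norm_integral_le_of_norm_le_const (μ := μ) (f := f) (Eventually.of_forall hK)

lemma sq_integral_le {α : Type*} [MeasurableSpace α] {μ : Measure α} [IsProbabilityMeasure μ]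
    {f : α → ℝ} (hf : MemLp f 2 μ) : (∫ x, f x ∂μ) ^ 2 ≤ ∫ x, f x ^ 2 ∂μ := by
  have h := variance_nonneg f μ
  rw [variance_eq_sub hf] at h
  simpa using h

lemma integral_sub_sub_add {α : Type*} [MeasurableSpace α] {μ : Measure α} {f g h k : α → ℝ}
    (hf : Integrable f μ) (hg : Integrable g μ) (hh : Integrable h μ) (hk : Integrable k μ) :
    ∫ x, (f x - g x - h x + k x) ∂μ
      = ∫ x, f x ∂μ - ∫ x, g x ∂μ - ∫ x, h x ∂μ + ∫ x, k x ∂μ := by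
  have h1 : Integrable (fun x => f x - g x) μ := hf.sub hg
  have h2 : Integrable (fun x => f x - g x - h x) μ := h1.sub hh
  rw [← integral_sub hf hg, ← integral_sub h1 hh, ← integral_add h2 hk]

lemma abs_mul_le_mul_self {a b K : ℝ} (ha : |a| ≤ K) (hb : |b| ≤ K) : |a * b| ≤ K * K := by
  rw [abs_mul]
  exact mul_le_mul ha hb (abs_nonneg _) ((abs_nonneg _).trans ha)

lemma abs_sub_le_two_mul {a b K : ℝ} (ha : |a| ≤ K) (hb : |b| ≤ K) : |a - b| ≤ 2 * K := by
  have := abs_sub a b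
  linarith

variable {M : Type*} [AddCommMonoid M] [MeasurableSpace M] [MeasurableAdd₂ M]
  {ρ : Measure M} {F : M → ℝ} {K : ℝ}

/-- The average of `F` over the addition of `m` independent jumps. -/
noncomputable def jumpAverage (ρ : Measure M) (F : M → ℝ) (m : ℕ) (w : M) : ℝ :=
  ∫ y, F (w + y) ∂(addConvPow ρ m)

lemma jumpAverage_zero (hF : Measurable F) : jumpAverage ρ F 0 = F := by
  funext w
  exact (integral_dirac' _ _ (hF.comp (measurable_const_add w)).stronglyMeasurable).trans (by simp)

variable [IsProbabilityMeasure ρ]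

lemma addConvPow_add (k m : ℕ) :
    addConvPow ρ (k + m) = (addConvPow ρ k).conv (addConvPow ρ m) := by
  induction m with
  | zero => simp [addConvPow]
  | succ m ih => rw [← add_assoc, addConvPow, ih, addConvPow, Measure.conv_assoc]

lemma measurable_jumpAverage (hF : Measurable F) (m : ℕ) : Measurable (jumpAverage ρ F m) :=
  ((hF.comp measurable_add).stronglyMeasurable.integral_prod_right'
    (ν := addConvPow ρ m)).measurable

lemma abs_jumpAverage_le (hK : ∀ x, |F x| ≤ K) (m : ℕ) (w : M) : |jumpAverage ρ F m w| ≤ K :=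
  abs_integral_le_of_abs_le fun _ => hK _

/-- Commutativity allows one of the `m + 1` jumps to be integrated last, as a shift of the base
point. -/
lemma jumpAverage_succ (hF : Measurable F) (hK : ∀ x, |F x| ≤ K) (m : ℕ) (w : M) :
    jumpAverage ρ F (m + 1) w = ∫ z, jumpAverage ρ F m (w + z) ∂ρ := by
  have hFw : Measurable fun y => F (w + y) := hF.comp (measurable_const_add w)
  rw [jumpAverage, addConvPow, Measure.conv_comm,
    integral_conv (integrable_of_abs_le hFw fun _ => hK _)]
  simp only [jumpAverage, add_assoc]

/-- Jensen: the increment of an average is the average of the increments. -/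
lemma sq_jumpAverage_sub_le (hF : Measurable F) (hK : ∀ x, |F x| ≤ K) (m : ℕ) (w z : M) :
    (jumpAverage ρ F m (w + z) - jumpAverage ρ F m w) ^ 2
      ≤ ∫ y, (F (w + y + z) - F (w + y)) ^ 2 ∂(addConvPow ρ m) := by
  have h1 : Measurable fun y => F (w + z + y) := hF.comp (measurable_const_add _)
  have h2 : Measurable fun y => F (w + y) := hF.comp (measurable_const_add _)
  rw [jumpAverage, jumpAverage, ← integral_sub (integrable_of_abs_le h1 fun _ => hK _)
    (integrable_of_abs_le h2 fun _ => hK _)]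
  simp only [add_right_comm w _ z]
  exact sq_integral_le (MemLp.of_bound (h1.sub h2).aestronglyMeasurable (2 * K)
    (Eventually.of_forall fun _ => abs_sub_le_two_mul (hK _) (hK _)))

/-- The Poincaré inequality for compound Poisson laws, bounded functions. -/
theorem compoundPoissonLaw_poincare_of_bounded (r : ℝ≥0) (hF : Measurable F)
    (hK : ∀ x, |F x| ≤ K) :
    ∫ w, F w ^ 2 ∂(compoundPoissonLaw r ρ) - (∫ w, F w ∂(compoundPoissonLaw r ρ)) ^ 2
      ≤ r * ∫ p : M × M, (F (p.1 + p.2) - F p.1) ^ 2 ∂((compoundPoissonLaw r ρ).prod ρ) := by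
  have hmJ := measurable_jumpAverage (ρ := ρ) hF
  have hbJ := abs_jumpAverage_le (ρ := ρ) hK
  have hmJ2 : ∀ m, Measurable fun p : M × M => jumpAverage ρ F m (p.1 + p.2) := fun m =>
    (hmJ m).comp measurable_add
  have hmJ1 : ∀ m, Measurable fun p : M × M => jumpAverage ρ F m p.1 := fun m =>
    (hmJ m).comp measurable_fst
  have hmD : Measurable fun p : M × M => (F (p.1 + p.2) - F p.1) ^ 2 :=
    ((hF.comp measurable_add).sub (hF.comp measurable_fst)).pow_const 2
  have hbD : ∀ w z, |(F (w + z) - F w) ^ 2| ≤ 2 * K * (2 * K) := fun w z => by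
    rw [sq]
    exact abs_mul_le_mul_self (abs_sub_le_two_mul (hK _) (hK _)) (abs_sub_le_two_mul (hK _) (hK _))
  let H : M → ℝ := fun w => ∫ z, (F (w + z) - F w) ^ 2 ∂ρ
  have hmH : Measurable H := (hmD.stronglyMeasurable.integral_prod_right' (ν := ρ)).measurable
  have hbH : ∀ w, |H w| ≤ 2 * K * (2 * K) := fun w => abs_integral_le_of_abs_le fun z => hbD w z
  let b : BoundedFun ℕ := BoundedFun.mk (fun n => ∫ w, H w ∂(addConvPow ρ n)) (2 * K * (2 * K))
    fun n => abs_integral_le_of_abs_le hbH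
  -- With `k` shared and `m`, `m'` private jumps, this is the mean product of the values of `F` at
  -- the two copies.
  let A : BoundedFun (ℕ × ℕ × ℕ) := BoundedFun.mk (fun p =>
    ∫ w, jumpAverage ρ F p.2.1 w * jumpAverage ρ F p.2.2 w ∂(addConvPow ρ p.1)) (K * K) fun p =>
      abs_integral_le_of_abs_le fun w => abs_mul_le_mul_self (hbJ _ _) (hbJ _ _)
  -- After Jensen and Fubini, the `k` base jumps and the `m` averaged ones merge into `k + m`
  -- independent jumps.
  have hkey : ∀ k m, ∫ w, (∫ z, (jumpAverage ρ F m (w + z) - jumpAverage ρ F m w) ^ 2 ∂ρ)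
      ∂(addConvPow ρ k) ≤ b (k + m) := by
    intro k m
    have hm3 : Measurable fun p : (M × M) × M => (F (p.1.1 + p.2 + p.1.2) - F (p.1.1 + p.2)) ^ 2 :=
      ((hF.comp (by fun_prop)).sub (hF.comp (by fun_prop))).pow_const 2
    have hswap : ∀ w, ∫ z, (∫ y, (F (w + y + z) - F (w + y)) ^ 2 ∂(addConvPow ρ m)) ∂ρ
        = ∫ y, H (w + y) ∂(addConvPow ρ m) := fun w =>
      integral_integral_swap (f := fun z y => (F (w + y + z) - F (w + y)) ^ 2)
        (integrable_of_abs_le (((hF.comp (by fun_prop)).sub (hF.comp (by fun_prop))).pow_const 2)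
          fun p => hbD _ _)
    have hb : b (k + m) = ∫ w, (∫ y, H (w + y) ∂(addConvPow ρ m)) ∂(addConvPow ρ k) := by
      change ∫ w, H w ∂(addConvPow ρ (k + m)) = _
      rw [addConvPow_add, integral_conv (integrable_of_abs_le hmH hbH)]
    rw [hb]
    refine integral_mono_of_nonneg
      (Eventually.of_forall fun w => integral_nonneg fun z => sq_nonneg _)
      (integrable_of_abs_le (((hmH.comp measurable_add).stronglyMeasurable.integral_prod_right'
        (ν := addConvPow ρ m)).measurable) fun w => abs_integral_le_of_abs_le fun y => hbH (w + y))
      (Eventually.of_forall fun w => ?_)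
    dsimp only
    rw [← hswap]
    refine integral_mono_of_nonneg (Eventually.of_forall fun z => sq_nonneg _)
      (integrable_of_abs_le ?_ fun z => abs_integral_le_of_abs_le fun y => hbD (w + y) z)
      (Eventually.of_forall fun z => sq_jumpAverage_sub_le hF hK m w z)
    have hm2 : Measurable fun p : M × M => (F (w + p.2 + p.1) - F (w + p.2)) ^ 2 :=
      ((hF.comp (by fun_prop)).sub (hF.comp (by fun_prop))).pow_const 2
    exact (hm2.stronglyMeasurable.integral_prod_right' (ν := addConvPow ρ m)).measurable
  have hprod : ∀ m m' w, |jumpAverage ρ F m w * jumpAverage ρ F m' w| ≤ K * K := fun m m' w =>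
    abs_mul_le_mul_self (hbJ _ _) (hbJ _ _)
  -- Averaging over the extra jump `z` turns an `m`-jump average into an `(m + 1)`-jump one;
  -- integrated over the base point, the four terms become those of `interpGen`.
  have hexp : ∀ m m' w, ∫ z, (jumpAverage ρ F m (w + z) - jumpAverage ρ F m w)
        * (jumpAverage ρ F m' (w + z) - jumpAverage ρ F m' w) ∂ρ
      = (∫ z, jumpAverage ρ F m (w + z) * jumpAverage ρ F m' (w + z) ∂ρ)
        - jumpAverage ρ F (m + 1) w * jumpAverage ρ F m' w
        - jumpAverage ρ F m w * jumpAverage ρ F (m' + 1) w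
        + jumpAverage ρ F m w * jumpAverage ρ F m' w := by
    intro m m' w
    have hu : ∀ m, Integrable (fun z => jumpAverage ρ F m (w + z)) ρ := fun m =>
      integrable_of_abs_le ((hmJ m).comp (measurable_const_add w)) fun z => hbJ m _
    have huv : Integrable (fun z => jumpAverage ρ F m (w + z) * jumpAverage ρ F m' (w + z)) ρ :=
      integrable_of_abs_le (((hmJ m).comp (measurable_const_add w)).mul
        ((hmJ m').comp (measurable_const_add w))) fun z => hprod m m' _
    have hc : jumpAverage ρ F m w * jumpAverage ρ F m' w
        = ∫ _, jumpAverage ρ F m w * jumpAverage ρ F m' w ∂ρ := by simp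
    rw [jumpAverage_succ hF hK m, jumpAverage_succ hF hK m', ← integral_mul_const,
      ← integral_const_mul, hc, ← integral_sub_sub_add huv ((hu m).mul_const _)
        ((hu m').const_mul _) (integrable_const _)]
    refine integral_congr_ae (Eventually.of_forall fun z => ?_)
    ring
  have hsqm : ∀ m, Measurable fun p : M × M =>
      (jumpAverage ρ F m (p.1 + p.2) - jumpAverage ρ F m p.1) ^ 2 := fun m =>
    ((hmJ2 m).sub (hmJ1 m)).pow_const 2
  have hsqb : ∀ m w z, |(jumpAverage ρ F m (w + z) - jumpAverage ρ F m w) ^ 2|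
      ≤ 2 * K * (2 * K) := fun m w z => by
    rw [sq]
    exact abs_mul_le_mul_self (abs_sub_le_two_mul (hbJ _ _) (hbJ _ _))
      (abs_sub_le_two_mul (hbJ _ _) (hbJ _ _))
  have hsqi : ∀ m w, Integrable (fun z =>
      (jumpAverage ρ F m (w + z) - jumpAverage ρ F m w) ^ 2) ρ := fun m w =>
    integrable_of_abs_le ((hsqm m).comp measurable_prodMk_left) fun z => hsqb m w z
  have hsqI : ∀ k m, Integrable (fun w => ∫ z,
      (jumpAverage ρ F m (w + z) - jumpAverage ρ F m w) ^ 2 ∂ρ) (addConvPow ρ k) := fun k m =>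
    integrable_of_abs_le ((hsqm m).stronglyMeasurable.integral_prod_right' (ν := ρ)).measurable
      fun w => abs_integral_le_of_abs_le fun z => hsqb m w z
  have hint := BoundedFun.poisson_interpolation r A b fun k m m' => by
    have hi : ∀ m m', Integrable (fun w => jumpAverage ρ F m w * jumpAverage ρ F m' w)
        (addConvPow ρ k) := fun m m' => integrable_of_abs_le ((hmJ m).mul (hmJ m')) (hprod m m')
    have hi2 : Integrable (fun w => ∫ z, jumpAverage ρ F m (w + z) * jumpAverage ρ F m' (w + z) ∂ρ)
        (addConvPow ρ k) :=
      integrable_of_abs_le (((hmJ2 m).mul (hmJ2 m')).stronglyMeasurable.integral_prod_right'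
        (ν := ρ)).measurable fun w => abs_integral_le_of_abs_le fun z => hprod m m' _
    have hA1 : A (k + 1, m, m') = ∫ w, (∫ z, jumpAverage ρ F m (w + z)
        * jumpAverage ρ F m' (w + z) ∂ρ) ∂(addConvPow ρ k) :=
      integral_conv (integrable_of_abs_le ((hmJ m).mul (hmJ m')) (hprod m m'))
    have hsum : A (k + 1, m, m') - A (k, m + 1, m') - A (k, m, m' + 1) + A (k, m, m')
        = ∫ w, (∫ z, (jumpAverage ρ F m (w + z) - jumpAverage ρ F m w)
          * (jumpAverage ρ F m' (w + z) - jumpAverage ρ F m' w) ∂ρ) ∂(addConvPow ρ k) := by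
      simp only [hexp]
      rw [integral_sub_sub_add hi2 (hi _ _) (hi _ _) (hi _ _), hA1]
      rfl
    have hle : ∀ w, ∫ z, (jumpAverage ρ F m (w + z) - jumpAverage ρ F m w)
          * (jumpAverage ρ F m' (w + z) - jumpAverage ρ F m' w) ∂ρ
        ≤ ((∫ z, (jumpAverage ρ F m (w + z) - jumpAverage ρ F m w) ^ 2 ∂ρ)
          + ∫ z, (jumpAverage ρ F m' (w + z) - jumpAverage ρ F m' w) ^ 2 ∂ρ) / 2 := by
      intro w
      rw [← integral_add (hsqi m w) (hsqi m' w), ← integral_div]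
      refine integral_mono (integrable_of_abs_le ?_ fun z => abs_mul_le_mul_self
        (abs_sub_le_two_mul (hbJ m _) (hbJ m _)) (abs_sub_le_two_mul (hbJ m' _) (hbJ m' _)))
        (((hsqi m w).add (hsqi m' w)).div_const 2) fun z => ?_
      · exact (((hmJ m).comp (measurable_const_add w)).sub_const _).mul
          (((hmJ m').comp (measurable_const_add w)).sub_const _)
      · dsimp only
        linarith [two_mul_le_add_sq (jumpAverage ρ F m (w + z) - jumpAverage ρ F m w)
          (jumpAverage ρ F m' (w + z) - jumpAverage ρ F m' w)]
    rw [hsum]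
    calc _ ≤ ∫ w, ((∫ z, (jumpAverage ρ F m (w + z) - jumpAverage ρ F m w) ^ 2 ∂ρ)
          + ∫ z, (jumpAverage ρ F m' (w + z) - jumpAverage ρ F m' w) ^ 2 ∂ρ) / 2
            ∂(addConvPow ρ k) := by
          refine integral_mono ?_ (((hsqI k m).add (hsqI k m')).div_const 2) hle
          simp only [hexp]
          exact ((hi2.sub (hi _ _)).sub (hi _ _)).add (hi _ _)
      _ ≤ (b (k + m) + b (k + m')) / 2 := by
          rw [integral_div, integral_add (hsqI k m) (hsqI k m')]
          linarith [hkey k m, hkey k m']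
  have hmF2 : Measurable fun w => F w ^ 2 := hF.pow_const 2
  have e1 : ∫ n, A (n, 0, 0) ∂(poissonMeasure r) = ∫ w, F w ^ 2 ∂(compoundPoissonLaw r ρ) := by
    rw [integral_compoundPoissonLaw (K := K * K) r hmF2.aestronglyMeasurable fun w => by
      rw [Real.norm_eq_abs, sq]
      exact abs_mul_le_mul_self (hK w) (hK w)]
    refine integral_congr_ae (Eventually.of_forall fun n => ?_)
    change ∫ w, jumpAverage ρ F 0 w * jumpAverage ρ F 0 w ∂(addConvPow ρ n) = _
    simp only [jumpAverage_zero hF, sq]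
  have e2 : ∫ m, (∫ m', A (0, m, m') ∂(poissonMeasure r)) ∂(poissonMeasure r)
      = (∫ w, F w ∂(compoundPoissonLaw r ρ)) ^ 2 := by
    rw [integral_compoundPoissonLaw r hF.aestronglyMeasurable hK]
    have hA0 : ∀ m m', A (0, m, m')
        = (∫ w, F w ∂(addConvPow ρ m)) * ∫ w, F w ∂(addConvPow ρ m') := by
      intro m m'
      change ∫ w, jumpAverage ρ F m w * jumpAverage ρ F m' w ∂(Measure.dirac 0) = _
      exact (integral_dirac' _ _ ((hmJ m).mul (hmJ m')).stronglyMeasurable).trans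
        (by simp [jumpAverage])
    simp only [hA0, integral_const_mul, integral_mul_const, sq]
  have e3 : ∫ n, b n ∂(poissonMeasure r)
      = ∫ p : M × M, (F (p.1 + p.2) - F p.1) ^ 2 ∂((compoundPoissonLaw r ρ).prod ρ) := by
    rw [integral_prod _ (integrable_of_abs_le hmD fun p => hbD _ _)]
    exact (integral_compoundPoissonLaw r hmH.aestronglyMeasurable hbH).symm
  rwa [e1, e2, e3] at hint

/-- The Poincaré inequality for compound Poisson laws. -/
theorem compoundPoissonLaw_poincare (r : ℝ≥0) (hF : Measurable F)
    (hF2 : MemLp F 2 (compoundPoissonLaw r ρ))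
    (hD : Integrable (fun p : M × M => (F (p.1 + p.2) - F p.1) ^ 2)
      ((compoundPoissonLaw r ρ).prod ρ)) :
    ∫ w, F w ^ 2 ∂(compoundPoissonLaw r ρ)
      ≤ r * ∫ p : M × M, (F (p.1 + p.2) - F p.1) ^ 2 ∂((compoundPoissonLaw r ρ).prod ρ)
        + (∫ w, F w ∂(compoundPoissonLaw r ρ)) ^ 2 := by
  set μ := compoundPoissonLaw r ρ
  -- Truncation at level `n` is 1-Lipschitz, so it does not increase the energy; dominated
  -- convergence handles the two moments.
  let Fn : ℕ → M → ℝ := fun n w => max (-n) (min n (F w))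
  have hmn : ∀ n, Measurable (Fn n) := fun n => measurable_const.max (measurable_const.min hF)
  have hbn : ∀ n w, |Fn n w| ≤ n := fun n w => by
    rw [abs_le]
    exact ⟨le_max_left _ _, max_le (by linarith [n.cast_nonneg (α := ℝ)]) (min_le_left _ _)⟩
  have hle : ∀ n w, |Fn n w| ≤ |F w| := fun n w => by
    have hn := n.cast_nonneg (α := ℝ)
    rw [abs_le]
    exact ⟨le_max_of_le_right (le_min (by linarith [abs_nonneg (F w)]) (neg_abs_le _)),
      max_le (by linarith [abs_nonneg (F w)]) ((min_le_right _ _).trans (le_abs_self _))⟩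
  have hcontr : ∀ n w w', (Fn n w - Fn n w') ^ 2 ≤ (F w - F w') ^ 2 := fun n w w' => by
    rw [sq_le_sq]
    exact (abs_max_sub_max_le_max (-(n : ℝ)) _ _ _).trans (max_le (by simp)
      ((abs_min_sub_min_le_max (n : ℝ) (F w) n (F w')).trans (by simp)))
  have hlim : ∀ w, Tendsto (fun n => Fn n w) atTop (𝓝 (F w)) := fun w => by
    obtain ⟨N, hN⟩ := exists_nat_ge |F w|
    refine tendsto_const_nhds.congr' ?_
    filter_upwards [eventually_ge_atTop N] with n hn
    have h := abs_le.1 (hN.trans (Nat.cast_le.2 hn))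
    exact ((max_eq_right (le_min (by linarith) h.1)).trans (min_eq_right h.2)).symm
  have h1 : Tendsto (fun n => ∫ w, Fn n w ^ 2 ∂μ) atTop (𝓝 (∫ w, F w ^ 2 ∂μ)) := by
    refine tendsto_integral_of_dominated_convergence (fun w => F w ^ 2)
      (fun n => ((hmn n).pow_const 2).aestronglyMeasurable) hF2.integrable_sq
      (fun n => Eventually.of_forall fun w => ?_) (Eventually.of_forall fun w => (hlim w).pow 2)
    rw [Real.norm_eq_abs, abs_pow, ← sq_abs (F w)]
    exact pow_le_pow_left₀ (abs_nonneg _) (hle n w) 2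
  have h2 : Tendsto (fun n => ∫ w, Fn n w ∂μ) atTop (𝓝 (∫ w, F w ∂μ)) :=
    tendsto_integral_of_dominated_convergence (fun w => |F w|)
      (fun n => (hmn n).aestronglyMeasurable) (hF2.integrable (by norm_num)).abs
      (fun n => Eventually.of_forall fun w => hle n w) (Eventually.of_forall hlim)
  refine le_of_tendsto_of_tendsto' h1 ((h2.pow 2).const_add _) fun n => ?_
  have h3 : ∫ w, Fn n w ^ 2 ∂μ - (∫ w, Fn n w ∂μ) ^ 2
      ≤ r * ∫ p : M × M, (Fn n (p.1 + p.2) - Fn n p.1) ^ 2 ∂(μ.prod ρ) :=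
    compoundPoissonLaw_poincare_of_bounded r (hmn n) (hbn n)
  have h4 : ∫ p : M × M, (Fn n (p.1 + p.2) - Fn n p.1) ^ 2 ∂(μ.prod ρ)
      ≤ ∫ p : M × M, (F (p.1 + p.2) - F p.1) ^ 2 ∂(μ.prod ρ) :=
    integral_mono_of_nonneg (Eventually.of_forall fun p => sq_nonneg _) hD
      (Eventually.of_forall fun p => hcontr n _ _)
  have h5 := mul_le_mul_of_nonneg_left h4 r.coe_nonneg
  linarith

end CompoundPoissonPoincare

/-! ### Path space as a commutative monoid, and one-jump paths. -/

namespace CadlagPath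

variable {T : ℝ} {d : ℕ}

instance : Zero (CadlagPath T d) :=
  ⟨⟨fun _ => 0, fun _ => ⟨continuousWithinAt_const, 0, tendsto_const_nhds⟩⟩⟩

instance : Add (CadlagPath T d) :=
  ⟨fun ω η => ⟨fun s => ω s + η s, fun s => by
    obtain ⟨h1, l, hl⟩ := ω.2 s
    obtain ⟨h2, l', hl'⟩ := η.2 s
    exact ⟨h1.add h2, l + l', hl.add hl'⟩⟩⟩

@[simp] lemma zero_apply (s : Set.Icc (0 : ℝ) T) : (0 : CadlagPath T d) s = 0 := rfl

@[simp] lemma add_apply (ω η : CadlagPath T d) (s : Set.Icc (0 : ℝ) T) :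
    (ω + η) s = ω s + η s := rfl

lemma ext_apply {ω η : CadlagPath T d} (h : ∀ s, ω s = η s) : ω = η := Subtype.ext (funext h)

instance : AddCommMonoid (CadlagPath T d) where
  add_assoc a b c := ext_apply fun s => add_assoc (a s) (b s) (c s)
  zero_add a := ext_apply fun s => zero_add (a s)
  add_zero a := ext_apply fun s => add_zero (a s)
  add_comm a b := ext_apply fun s => add_comm (a s) (b s)
  nsmul := nsmulRec

/-- The underlying function of a path. -/
def toFun (ω : CadlagPath T d) : Set.Icc (0 : ℝ) T → EuclideanSpace ℝ (Fin d) := ω.1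

lemma measurable_toFun : Measurable (toFun : CadlagPath T d → _) :=
  comap_measurable _

@[fun_prop]
lemma measurable_eval (s : Set.Icc (0 : ℝ) T) : Measurable fun ω : CadlagPath T d => ω s :=
  (measurable_pi_apply s).comp measurable_toFun

lemma measurable_of_eval {α : Type*} [MeasurableSpace α] {f : α → CadlagPath T d}
    (h : ∀ s, Measurable fun a => f a s) : Measurable f :=
  measurable_comap_iff.2 (measurable_pi_iff.2 h)

instance : MeasurableAdd₂ (CadlagPath T d) :=
  ⟨measurable_of_eval fun s => ((measurable_eval s).comp measurable_fst).add
    ((measurable_eval s).comp measurable_snd)⟩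

/-- The path `x 1_{[t,T]}`. -/
noncomputable def jump (t : ℝ) (x : EuclideanSpace ℝ (Fin d)) : CadlagPath T d :=
  addJump 0 t x

lemma jump_apply (t : ℝ) (x : EuclideanSpace ℝ (Fin d)) (s : Set.Icc (0 : ℝ) T) :
    (jump t x : CadlagPath T d) s = if t ≤ s then x else 0 := by
  have : (jump t x : CadlagPath T d) s = 0 + (Set.Icc t T).indicator (fun _ => x) (s : ℝ) := rfl
  rw [this, zero_add, Set.indicator_apply]
  simp [s.2.2]

lemma addJump_eq (ω : CadlagPath T d) (t : ℝ) (x : EuclideanSpace ℝ (Fin d)) :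
    ω.addJump t x = ω + jump t x := by
  refine ext_apply fun s => ?_
  have h1 : ω.addJump t x s = ω s + (Set.Icc t T).indicator (fun _ => x) (s : ℝ) := rfl
  have h2 : (jump t x : CadlagPath T d) s = 0 + (Set.Icc t T).indicator (fun _ => x) (s : ℝ) := rfl
  rw [h1, add_apply, h2, zero_add]

lemma measurable_jump :
    Measurable fun p : ℝ × EuclideanSpace ℝ (Fin d) => (jump p.1 p.2 : CadlagPath T d) := by
  refine measurable_of_eval fun s => ?_
  simp only [jump_apply]
  exact Measurable.ite (measurableSet_le measurable_fst measurable_const) measurable_snd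
    measurable_const

/-- The law of the path with a single jump, at a uniform time and with jump law `ν`. -/
noncomputable def jumpLaw (T : ℝ) {d : ℕ} (ν : Measure (EuclideanSpace ℝ (Fin d))) :
    Measure (CadlagPath T d) :=
  ((ENNReal.ofReal T⁻¹ • volume.restrict (Set.Icc 0 T)).prod ν).map fun p => jump p.1 p.2

lemma isProbabilityMeasure_uniform (hT : 0 < T) :
    IsProbabilityMeasure (ENNReal.ofReal T⁻¹ • (volume.restrict (Set.Icc 0 T) : Measure ℝ)) := by
  constructor
  rw [Measure.smul_apply, Measure.restrict_apply_univ, Real.volume_Icc, smul_eq_mul,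
    ← ENNReal.ofReal_mul (inv_nonneg.2 hT.le), sub_zero, inv_mul_cancel₀ hT.ne',
    ENNReal.ofReal_one]

lemma isProbabilityMeasure_jumpLaw (hT : 0 < T) (ν : Measure (EuclideanSpace ℝ (Fin d)))
    [IsProbabilityMeasure ν] : IsProbabilityMeasure (jumpLaw T ν) := by
  have := isProbabilityMeasure_uniform hT
  exact Measure.isProbabilityMeasure_map measurable_jump.aemeasurable

lemma jumpLaw_eq_smul (ν : Measure (EuclideanSpace ℝ (Fin d))) [SFinite ν] :
    jumpLaw T ν = ENNReal.ofReal T⁻¹ •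
      ((volume.restrict (Set.Icc 0 T)).prod ν).map fun p => (jump p.1 p.2 : CadlagPath T d) := by
  rw [jumpLaw, Measure.prod_smul_left, Measure.map_smul]

lemma integral_jumpLaw (hT : 0 < T) (ν : Measure (EuclideanSpace ℝ (Fin d)))
    [IsProbabilityMeasure ν] {f : CadlagPath T d → ℂ} (hf : Measurable f) {K : ℝ}
    (hK : ∀ ω, ‖f ω‖ ≤ K) :
    ∫ ω, f ω ∂(jumpLaw T ν) = (T : ℂ)⁻¹ * ∫ s in Set.Icc 0 T, ∫ x, f (jump s x) ∂ν := by
  rw [jumpLaw_eq_smul, integral_smul_measure,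
    integral_map measurable_jump.aemeasurable hf.aestronglyMeasurable,
    ENNReal.toReal_ofReal (inv_nonneg.2 hT.le), Complex.real_smul, Complex.ofReal_inv,
    integral_prod (fun p : ℝ × EuclideanSpace ℝ (Fin d) => f (jump p.1 p.2)) (Integrable.of_bound
      (hf.comp measurable_jump).aestronglyMeasurable K (Eventually.of_forall fun p => hK _))]

/-- A path law is determined by the laws of its increments if the paths start from `0`. -/
lemma ext_of_increments (hT : 0 ≤ T) {μ μ' : Measure (CadlagPath T d)} [IsFiniteMeasure μ]
    [IsFiniteMeasure μ']
    (h0 : ∀ᵐ ω ∂μ, ω ⟨0, Set.left_mem_Icc.2 hT⟩ = 0)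
    (h0' : ∀ᵐ ω ∂μ', ω ⟨0, Set.left_mem_Icc.2 hT⟩ = 0)
    (h : ∀ t : ℕ → Set.Icc (0 : ℝ) T, Monotone t → ∀ n : ℕ,
      μ.map (fun ω (j : Fin n) => ω (t (j + 1)) - ω (t j))
        = μ'.map (fun ω (j : Fin n) => ω (t (j + 1)) - ω (t j))) : μ = μ' := by
  have hval : μ.map toFun = μ'.map toFun := by
    have hfin : IsFiniteMeasure (μ.map (toFun : CadlagPath T d → _)) :=
      Measure.isFiniteMeasure_map _ _
    -- The finite-dimensional marginals determine a finite measure on the product space, as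
    -- projective limits are unique.
    have hP : ∀ I : Finset (Set.Icc (0 : ℝ) T),
        IsFiniteMeasure ((μ.map (toFun : CadlagPath T d → _)).map I.restrict) := fun I =>
      Measure.isFiniteMeasure_map _ _
    refine IsProjectiveLimit.unique (P := fun I => (μ.map toFun).map I.restrict)
      (fun I => rfl) fun I => ?_
    change (μ'.map toFun).map I.restrict = (μ.map toFun).map I.restrict
    rw [Measure.map_map (Finset.measurable_restrict I) measurable_toFun,
      Measure.map_map (Finset.measurable_restrict I) measurable_toFun]
    let z : Set.Icc (0 : ℝ) T := ⟨0, Set.left_mem_Icc.2 hT⟩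
    let n := I.card
    let e := I.orderIsoOfFin (rfl : I.card = n)
    -- The grid starts at time `0`, then lists `I` in increasing order from index `1` on, and stays
    -- at the last point; for empty `I` it is constantly `0`.
    let t : ℕ → Set.Icc (0 : ℝ) T := fun j =>
      if hj : 0 < j ∧ 0 < n then (e ⟨min (j - 1) (n - 1), by omega⟩ : Set.Icc (0 : ℝ) T) else z
    have ht : Monotone t := by
      intro i j hij
      by_cases hi : 0 < i ∧ 0 < n
      · have hj : 0 < j ∧ 0 < n := ⟨by omega, hi.2⟩
        simp only [t, dif_pos hi, dif_pos hj]
        refine e.monotone ?_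
        rw [Fin.mk_le_mk]
        omega
      · simp only [t, dif_neg hi]
        exact Subtype.coe_le_coe.1 (t j).2.1
    -- Partial sums recover the values at the points of `I` from the increments, once the path
    -- starts from `0`.
    let G : (Fin n → EuclideanSpace ℝ (Fin d)) → (I → EuclideanSpace ℝ (Fin d)) :=
      fun v i => ∑ j : Fin n, if (j : ℕ) ≤ (e.symm i : ℕ) then v j else 0
    have hG : Measurable G := by
      refine measurable_pi_iff.2 fun i => Finset.measurable_sum _ fun j _ => ?_
      split_ifs
      · exact measurable_pi_apply j
      · exact measurable_const
    have hinc : Measurable fun (ω : CadlagPath T d) (j : Fin n) => ω (t (j + 1)) - ω (t j) :=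
      measurable_pi_iff.2 fun j => (measurable_eval _).sub (measurable_eval _)
    have hrec : ∀ ω : CadlagPath T d, ω z = 0 →
        G (fun j : Fin n => ω (t (j + 1)) - ω (t j)) = I.restrict ω.toFun := by
      intro ω hω
      funext i
      have hk : (e.symm i : ℕ) < n := (e.symm i).2
      have h1 : G (fun j : Fin n => ω (t (j + 1)) - ω (t j)) i
          = ∑ j ∈ Finset.range n, if j ≤ (e.symm i : ℕ) then ω (t (j + 1)) - ω (t j) else 0 :=
        (Finset.sum_range fun j => if j ≤ (e.symm i : ℕ) then ω (t (j + 1)) - ω (t j) else 0).symm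
      have h2 : (Finset.range n).filter (fun j => j ≤ (e.symm i : ℕ))
          = Finset.range ((e.symm i : ℕ) + 1) := by
        ext j
        simp only [Finset.mem_filter, Finset.mem_range]
        omega
      have h3 : t 0 = z := rfl
      have h4 : t ((e.symm i : ℕ) + 1) = i := by
        have hc : 0 < (e.symm i : ℕ) + 1 ∧ 0 < n := ⟨by omega, by omega⟩
        simp only [t, dif_pos hc]
        have : (⟨min ((e.symm i : ℕ) + 1 - 1) (n - 1), by omega⟩ : Fin n) = e.symm i :=
          Fin.ext (by simp only; omega)
        rw [this, OrderIso.apply_symm_apply]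
      rw [h1, ← Finset.sum_filter, h2, Finset.sum_range_sub (fun j => ω (t j)), h3, h4, hω,
        sub_zero]
      rfl
    have hμ : μ.map (I.restrict ∘ toFun)
        = (μ.map (fun ω (j : Fin n) => ω (t (j + 1)) - ω (t j))).map G := by
      rw [Measure.map_map hG hinc]
      exact Measure.map_congr (h0.mono fun ω hω => (hrec ω hω).symm)
    have hμ' : μ'.map (I.restrict ∘ toFun)
        = (μ'.map (fun ω (j : Fin n) => ω (t (j + 1)) - ω (t j))).map G := by
      rw [Measure.map_map hG hinc]
      exact Measure.map_congr (h0'.mono fun ω hω => (hrec ω hω).symm)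
    rw [hμ, hμ', h t ht n]
  ext s hs
  obtain ⟨u, hu, rfl⟩ := hs
  change μ (toFun ⁻¹' u) = μ' (toFun ⁻¹' u)
  rw [← Measure.map_apply measurable_toFun hu, ← Measure.map_apply measurable_toFun hu, hval]

/-- The interval is open on the left since a jump at time `s` is already present in the value at
`s`. -/
lemma increment_jump {a b : Set.Icc (0 : ℝ) T} (hab : a ≤ b) (s : ℝ)
    (x : EuclideanSpace ℝ (Fin d)) :
    (jump s x : CadlagPath T d) b - (jump s x : CadlagPath T d) a
      = (Set.Ioc (a : ℝ) b).indicator (fun _ => x) s := by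
  have hab' : (a : ℝ) ≤ b := hab
  simp only [jump_apply, Set.indicator_apply, Set.mem_Ioc]
  by_cases h1 : s ≤ a
  · simp [h1, h1.trans hab', not_lt.2 h1]
  · simp [h1, not_le.1 h1]

end CadlagPath

/-! ### Characters of vectors of increments. -/

section Character

variable {E : Type*} [NormedAddCommGroup E] [NormedSpace ℝ E]

lemma norm_cexp_dual (L : StrongDual ℝ E) (x : E) : ‖Complex.exp (L x * Complex.I)‖ ≤ 1 :=
  (Complex.norm_exp_ofReal_mul_I _).le

lemma cexp_dual_add (L : StrongDual ℝ E) (x y : E) :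
    Complex.exp (L (x + y) * Complex.I)
      = Complex.exp (L x * Complex.I) * Complex.exp (L y * Complex.I) := by
  rw [map_add, Complex.ofReal_add, add_mul, Complex.exp_add]

lemma charFunDual_compoundPoissonLaw [MeasurableSpace E] [BorelSpace E]
    [SecondCountableTopology E] (r : ℝ≥0) (ρ : Measure E) [IsProbabilityMeasure ρ]
    (L : StrongDual ℝ E) :
    charFunDual (compoundPoissonLaw r ρ) L = Complex.exp (r * (charFunDual ρ L - 1)) := by
  simp only [charFunDual_apply]
  exact integral_compoundPoissonLaw_of_mul r (by fun_prop) (norm_cexp_dual L) (by simp)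
    (cexp_dual_add L)

/-- On a family of pairwise disjoint sets, the character of a vector of indicators expands
additively. -/
lemma cexp_dual_indicator {ι : Type*} [Fintype ι] [DecidableEq ι] {S : ι → Set ℝ}
    (hS : Pairwise fun i j => Disjoint (S i) (S j)) (L : StrongDual ℝ (ι → E)) (s : ℝ) (x : E) :
    Complex.exp (L (fun j => (S j).indicator (fun _ => x) s) * Complex.I)
      = 1 + ∑ j, (S j).indicator (fun _ => Complex.exp (L (Pi.single j x) * Complex.I) - 1) s := by
  by_cases h : ∃ j, s ∈ S j
  · obtain ⟨j, hj⟩ := h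
    have hne : ∀ i, i ≠ j → s ∉ S i := fun i hij hi => Set.disjoint_left.1 (hS hij) hi hj
    have h1 : (fun i => (S i).indicator (fun _ => x) s) = Pi.single j x := by
      funext i
      by_cases hij : i = j
      · subst hij; simp [hj]
      · simp [hij, hne i hij]
    rw [h1, Finset.sum_eq_single j (fun i _ hij => Set.indicator_of_notMem (hne i hij) _) (by simp),
      Set.indicator_of_mem hj]
    ring
  · push Not at h
    have h1 : (fun i => (S i).indicator (fun _ => x) s) = 0 := by
      funext i
      simp [h i]
    rw [h1]
    simp [h]

end Character

/-! ### Identification of the law of the Poisson process. -/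

namespace CadlagPath

variable {T : ℝ} {d : ℕ}

/-- A single jump lies in at most one interval, so the character minus `1` is a sum over intervals;
integration over the jump time produces their lengths. The factor `T` cancels the uniform density.
-/
lemma integral_jumpLaw_increments (hT : 0 < T) (ν : Measure (EuclideanSpace ℝ (Fin d)))
    [IsProbabilityMeasure ν] {t : ℕ → Set.Icc (0 : ℝ) T} (ht : Monotone t) (n : ℕ)
    (L : StrongDual ℝ (Fin n → EuclideanSpace ℝ (Fin d))) :
    T * (∫ ω, Complex.exp (L (fun j : Fin n => ω (t (j + 1)) - ω (t j)) * Complex.I) ∂(jumpLaw T ν)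
        - 1)
      = ∑ j : Fin n, (((t (j + 1) : ℝ) - t j : ℝ) : ℂ)
        * (charFunDual ν (L.comp (.single ℝ (fun _ => EuclideanSpace ℝ (Fin d)) j)) - 1) := by
  have hinc : Measurable fun (ω : CadlagPath T d) (j : Fin n) => ω (t (j + 1)) - ω (t j) :=
    measurable_pi_iff.2 fun j => (measurable_eval _).sub (measurable_eval _)
  have hL : Measurable fun v => Complex.exp (L v * Complex.I) := by fun_prop
  rw [integral_jumpLaw (f := fun ω : CadlagPath T d =>
    Complex.exp (L (fun j : Fin n => ω (t (j + 1)) - ω (t j)) * Complex.I)) hT ν (hL.comp hinc) (fun ω => norm_cexp_dual L _)]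
  have hdisj : Pairwise fun i j : Fin n =>
      Disjoint (Set.Ioc (t i : ℝ) (t (i + 1))) (Set.Ioc (t j : ℝ) (t (j + 1))) := fun i j hij =>
    (Monotone.pairwise_disjoint_on_Ioc_succ (f := fun j => (t j : ℝ)) fun i j h => ht h)
      (fun h => hij (Fin.ext h))
  have hinner : ∀ s : ℝ, ∫ x, Complex.exp (L (fun j : Fin n =>
        (jump s x : CadlagPath T d) (t (j + 1)) - (jump s x : CadlagPath T d) (t j))
          * Complex.I) ∂ν
      = 1 + ∑ j : Fin n, (Set.Ioc (t j : ℝ) (t (j + 1))).indicator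
        (fun _ => charFunDual ν (L.comp (.single ℝ (fun _ => EuclideanSpace ℝ (Fin d)) j)) - 1) s := by
    intro s
    simp only [increment_jump (ht (Nat.le_succ _))]
    simp only [cexp_dual_indicator hdisj]
    have hi : ∀ j : Fin n, Integrable (fun x => Complex.exp (L (Pi.single j x) * Complex.I)) ν :=
      fun j => Integrable.of_bound ((by fun_prop : Measurable fun x => Complex.exp
        (L.comp (.single ℝ (fun _ => EuclideanSpace ℝ (Fin d)) j) x * Complex.I)
        ).aestronglyMeasurable) 1 (Eventually.of_forall fun x => norm_cexp_dual L _)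
    have hi' : ∀ j : Fin n, Integrable (fun x => (Set.Ioc (t j : ℝ) (t (j + 1))).indicator
        (fun _ => Complex.exp (L (Pi.single j x) * Complex.I) - 1) s) ν := by
      intro j
      by_cases hs : s ∈ Set.Ioc (t j : ℝ) (t (j + 1))
      · simp only [Set.indicator_of_mem hs]
        exact (hi j).sub (integrable_const _)
      · simp only [Set.indicator_of_notMem hs]
        exact integrable_zero _ _ _
    rw [integral_add (integrable_const _) (integrable_finsetSum _ fun j _ => hi' j),
      integral_finsetSum _ fun j _ => hi' j]
    simp only [integral_const, probReal_univ, one_smul]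
    congr 1
    refine Finset.sum_congr rfl fun j _ => ?_
    by_cases hs : s ∈ Set.Ioc (t j : ℝ) (t (j + 1))
    · simp only [Set.indicator_of_mem hs]
      rw [integral_sub (hi j) (integrable_const _)]
      simp [charFunDual_apply]
    · simp only [Set.indicator_of_notMem hs, integral_zero]
  simp only [hinner]
  have hind : ∀ (j : Fin n) (c : ℂ), Integrable
      ((Set.Ioc (t j : ℝ) (t (j + 1))).indicator fun _ => c) (volume.restrict (Set.Icc 0 T)) :=
    fun j c => (integrable_const c).indicator measurableSet_Ioc
  have hone : ∀ (j : Fin n) (c : ℂ),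
      ∫ s in Set.Icc 0 T, (Set.Ioc (t j : ℝ) (t (j + 1))).indicator (fun _ => c) s
        = (((t (j + 1) : ℝ) - t j : ℝ) : ℂ) * c := by
    intro j c
    have hsub : Set.Ioc (t j : ℝ) (t (j + 1)) ⊆ Set.Icc 0 T := fun s hs =>
      ⟨(t j).2.1.trans hs.1.le, hs.2.trans (t _).2.2⟩
    rw [setIntegral_indicator measurableSet_Ioc, Set.inter_eq_right.2 hsub, setIntegral_const,
      Real.volume_real_Ioc_of_le (ht (Nat.le_succ _)), Complex.real_smul]
  rw [integral_add (integrable_const _) (integrable_finsetSum _ fun j _ => hind j _),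
    integral_finsetSum _ fun j _ => hind j _, setIntegral_const,
    Real.volume_real_Icc_of_le hT.le]
  simp only [hone]
  have hT' : (T : ℂ) ≠ 0 := by exact_mod_cast hT.ne'
  rw [sub_zero, Complex.real_smul, mul_one, mul_sub, mul_one, ← mul_assoc, mul_inv_cancel₀ hT',
    one_mul, add_sub_cancel_left]

/-- The exponent of the joint characteristic function is a sum over intervals, so the function is
the product of those of the compound Poisson marginals. -/
lemma compoundPoissonLaw_map_increments (hT : 0 < T) (ν : Measure (EuclideanSpace ℝ (Fin d)))
    [IsProbabilityMeasure ν] {t : ℕ → Set.Icc (0 : ℝ) T} (ht : Monotone t) (n : ℕ) :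
    (compoundPoissonLaw T.toNNReal (jumpLaw T ν)).map
        (fun ω (j : Fin n) => ω (t (j + 1)) - ω (t j))
      = Measure.pi fun j : Fin n => compoundPoissonLaw ((t (j + 1) : ℝ) - t j).toNNReal ν := by
  have := isProbabilityMeasure_jumpLaw hT ν
  have hinc : Measurable fun (ω : CadlagPath T d) (j : Fin n) => ω (t (j + 1)) - ω (t j) :=
    measurable_pi_iff.2 fun j => (measurable_eval _).sub (measurable_eval _)
  have : IsProbabilityMeasure ((compoundPoissonLaw T.toNNReal (jumpLaw T ν)).map
      (fun ω (j : Fin n) => ω (t (j + 1)) - ω (t j))) :=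
    Measure.isProbabilityMeasure_map hinc.aemeasurable
  refine charFunDual_eq_pi_iff.1 fun L => ?_
  have hL : Measurable fun v => Complex.exp (L v * Complex.I) := by fun_prop
  rw [charFunDual_apply, integral_map hinc.aemeasurable hL.aestronglyMeasurable,
    integral_compoundPoissonLaw_of_mul (f := fun ω : CadlagPath T d =>
      Complex.exp (L (fun j : Fin n => ω (t (j + 1)) - ω (t j)) * Complex.I))
      T.toNNReal (hL.comp hinc) (fun ω => norm_cexp_dual L _)]
  · simp only [charFunDual_compoundPoissonLaw]
    rw [← Complex.exp_sum]
    congr 1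
    have h := integral_jumpLaw_increments hT ν ht n L
    have hr : ((T.toNNReal : ℝ) : ℂ) = T := by rw [Real.coe_toNNReal _ hT.le]
    rw [hr, h]
    refine Finset.sum_congr rfl fun j _ => ?_
    rw [Real.coe_toNNReal _ (sub_nonneg.2 (ht (Nat.le_succ (j : ℕ))))]
  · have : (fun j : Fin n => (0 : CadlagPath T d) (t (j + 1)) - (0 : CadlagPath T d) (t j)) = 0 := by
      funext j
      simp
    rw [this]
    simp
  · intro ω η
    rw [← cexp_dual_add]
    congr 4
    funext j
    simp only [add_apply, Pi.add_apply]
    abel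

lemma compoundPoissonLaw_start (hT : 0 < T) (ν : Measure (EuclideanSpace ℝ (Fin d)))
    [IsProbabilityMeasure ν] {z : Set.Icc (0 : ℝ) T} (hz : (z : ℝ) = 0) :
    ∀ᵐ ω ∂(compoundPoissonLaw T.toNNReal (jumpLaw T ν)), ω z = 0 := by
  have := isProbabilityMeasure_jumpLaw hT ν
  have hmap : (compoundPoissonLaw T.toNNReal (jumpLaw T ν)).map (fun ω => ω z)
      = Measure.dirac 0 := by
    have : IsProbabilityMeasure ((compoundPoissonLaw T.toNNReal (jumpLaw T ν)).map
      (fun ω => ω z)) := Measure.isProbabilityMeasure_map (measurable_eval z).aemeasurable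
    refine Measure.ext_of_charFunDual (funext fun L => ?_)
    have hL : Measurable fun v => Complex.exp (L v * Complex.I) := by fun_prop
    rw [charFunDual_apply, charFunDual_dirac,
      integral_map (measurable_eval z).aemeasurable hL.aestronglyMeasurable,
      integral_compoundPoissonLaw_of_mul (f := fun ω : CadlagPath T d =>
        Complex.exp (L (ω z) * Complex.I)) T.toNNReal (hL.comp (measurable_eval z))
        (fun ω => norm_cexp_dual L _) (by simp) (fun ω η => cexp_dual_add L _ _),
      integral_jumpLaw (f := fun ω : CadlagPath T d => Complex.exp (L (ω z) * Complex.I)) hT ν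
        (hL.comp (measurable_eval z)) (fun ω => norm_cexp_dual L _)]
    have h1 : ∫ s in Set.Icc 0 T, ∫ x, Complex.exp (L ((jump s x : CadlagPath T d) z) * Complex.I) ∂ν
        = ∫ s in Set.Icc 0 T, (1 : ℂ) := by
      refine setIntegral_congr_ae measurableSet_Icc ?_
      -- A jump at time exactly `0` would move the starting point, but has probability zero.
      filter_upwards [Measure.ae_ne volume (0 : ℝ)] with s hs hs'
      have : ¬ s ≤ (z : ℝ) := by
        rw [hz, not_le]
        exact lt_of_le_of_ne hs'.1 (Ne.symm hs)
      simp [jump_apply, this]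
    rw [h1]
    simp [hT.le, hT.ne']
  have hm : MeasurableSet {v : EuclideanSpace ℝ (Fin d) | v = 0} := measurableSet_eq
  rw [← ae_map_iff (measurable_eval z).aemeasurable hm, hmap, ae_dirac_iff hm]

/-- The law of the Poisson process with intensity `ν` is the compound Poisson law of
single-jump paths. -/
theorem law_eq_compoundPoissonLaw (hT : 0 < T) (ν : Measure (EuclideanSpace ℝ (Fin d)))
    [IsProbabilityMeasure ν] {Ω : Type*} [MeasurableSpace Ω] {P : Measure Ω}
    [IsProbabilityMeasure P] {X : Ω → CadlagPath T d} (hX : IsPoissonProcess ν P X)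
    {μ : Measure (CadlagPath T d)} (hμ : HasLaw X μ P) :
    μ = compoundPoissonLaw T.toNNReal (jumpLaw T ν) := by
  have := isProbabilityMeasure_jumpLaw hT ν
  have hμP : IsProbabilityMeasure μ := by
    rw [← hμ.map_eq]
    exact Measure.isProbabilityMeasure_map hμ.aemeasurable
  refine ext_of_increments hT.le ?_ (compoundPoissonLaw_start hT ν rfl) fun t ht n => ?_
  · rw [← hμ.map_eq]
    exact (ae_map_iff hμ.aemeasurable ((measurable_eval _) measurableSet_eq)).2
      (hX.start _ rfl)
  · have hinc : Measurable fun (ω : CadlagPath T d) (j : Fin n) => ω (t (j + 1)) - ω (t j) :=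
      measurable_pi_iff.2 fun j => (measurable_eval _).sub (measurable_eval _)
    rw [compoundPoissonLaw_map_increments hT ν ht n, ← hμ.map_eq,
      AEMeasurable.map_map_of_aemeasurable hinc.aemeasurable hμ.aemeasurable]
    have hind : iIndepFun (fun (j : Fin n) a => X a (t (j + 1)) - X a (t j)) P :=
      (hX.indep.nat ht).precomp Fin.val_injective
    have hlaw := fun j : Fin n => hX.increments (t j) (t (j + 1)) (ht (Nat.le_succ _))
    refine (iIndepFun.map_fun_eq_pi_map (fun j => (hlaw j).aemeasurable) hind).trans ?_
    congr 1
    funext j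
    rw [(hlaw j).map_eq, compoundPoisson_eq_compoundPoissonLaw]

end CadlagPath

/-! ### The form as a squared norm of the jump difference operator. -/

section JumpFormTheory

variable {T : ℝ} {d : ℕ}

/-- The increment of `F` under the addition of a jump. -/
noncomputable def jumpDiff (F : CadlagPath T d → ℝ)
    (p : CadlagPath T d × ℝ × EuclideanSpace ℝ (Fin d)) : ℝ :=
  F (p.1.addJump p.2.1 p.2.2) - F p.1

/-- The product of the path law, Lebesgue measure on `[0, T]` and the jump law. -/
noncomputable def jumpMeasure (ν : Measure (EuclideanSpace ℝ (Fin d)))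
    (μ : Measure (CadlagPath T d)) : Measure (CadlagPath T d × ℝ × EuclideanSpace ℝ (Fin d)) :=
  μ.prod ((volume.restrict (Set.Icc 0 T)).prod ν)

/-- The addition of a jump does not charge null sets. -/
def JumpQuasiInvariant (ν : Measure (EuclideanSpace ℝ (Fin d)))
    (μ : Measure (CadlagPath T d)) : Prop :=
  Measure.QuasiMeasurePreserving
    (fun p : CadlagPath T d × ℝ × EuclideanSpace ℝ (Fin d) => p.1.addJump p.2.1 p.2.2)
    (jumpMeasure ν μ) μ

lemma measurable_addJump :
    Measurable fun p : CadlagPath T d × ℝ × EuclideanSpace ℝ (Fin d) =>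
      p.1.addJump p.2.1 p.2.2 := by
  simp only [CadlagPath.addJump_eq]
  exact measurable_fst.add (CadlagPath.measurable_jump.comp measurable_snd)

lemma Measurable.jumpDiff {F : CadlagPath T d → ℝ} (hF : Measurable F) :
    Measurable (jumpDiff F) :=
  (hF.comp measurable_addJump).sub (hF.comp measurable_fst)

variable {ν : Measure (EuclideanSpace ℝ (Fin d))} {μ : Measure (CadlagPath T d)}

/-- Quasi-invariance is needed for the shifted term only; the other depends on the first coordinate.
-/
lemma jumpDiff_congr (hq : JumpQuasiInvariant ν μ) {F F' : CadlagPath T d → ℝ} (h : F =ᵐ[μ] F') :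
    jumpDiff F =ᵐ[jumpMeasure ν μ] jumpDiff F' := by
  filter_upwards [hq.ae_eq_comp h, Measure.quasiMeasurePreserving_fst.ae_eq_comp h] with p h1 h2
  exact congrArg₂ (· - ·) h1 h2

lemma measurable_coe_Lp (u : Lp ℝ 2 μ) : Measurable (u : CadlagPath T d → ℝ) :=
  (Lp.stronglyMeasurable u).measurable

lemma jumpDiff_add (hq : JumpQuasiInvariant ν μ) (u v : Lp ℝ 2 μ) :
    jumpDiff (u + v : Lp ℝ 2 μ) =ᵐ[jumpMeasure ν μ] jumpDiff u + jumpDiff v := by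
  filter_upwards [jumpDiff_congr hq (Lp.coeFn_add u v)] with p hp
  rw [hp]
  simp only [jumpDiff, Pi.add_apply]
  ring

lemma jumpDiff_sub (hq : JumpQuasiInvariant ν μ) (u v : Lp ℝ 2 μ) :
    jumpDiff (u - v : Lp ℝ 2 μ) =ᵐ[jumpMeasure ν μ] jumpDiff u - jumpDiff v := by
  filter_upwards [jumpDiff_congr hq (Lp.coeFn_sub u v)] with p hp
  rw [hp]
  simp only [jumpDiff, Pi.sub_apply]
  ring

lemma jumpDiff_smul (hq : JumpQuasiInvariant ν μ) (c : ℝ) (u : Lp ℝ 2 μ) :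
    jumpDiff (c • u : Lp ℝ 2 μ) =ᵐ[jumpMeasure ν μ] c • jumpDiff u := by
  filter_upwards [jumpDiff_congr hq (Lp.coeFn_smul c u)] with p hp
  rw [hp]
  simp only [jumpDiff, Pi.smul_apply, smul_eq_mul]
  ring

lemma jumpDiff_const (hq : JumpQuasiInvariant ν μ) {u : Lp ℝ 2 μ} {c : ℝ} (hu : u =ᵐ[μ] fun _ => c) :
    jumpDiff u =ᵐ[jumpMeasure ν μ] 0 := by
  filter_upwards [jumpDiff_congr hq hu] with p hp
  rw [hp]
  simp [jumpDiff]

variable [IsProbabilityMeasure ν]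

/-- Versions may be non-measurable functions, for which the iterated integrals need not be product
integrals; fibrewise almost everywhere equality still suffices. -/
lemma ae_ae_ae_of_ae_jumpMeasure {p : CadlagPath T d × ℝ × EuclideanSpace ℝ (Fin d) → Prop}
    (h : ∀ᵐ a ∂(jumpMeasure ν μ), p a) :
    ∀ᵐ ω ∂μ, ∀ᵐ t ∂(volume.restrict (Set.Icc 0 T)), ∀ᵐ x ∂ν, p (ω, t, x) := by
  filter_upwards [Measure.ae_ae_of_ae_prod h] with ω hω
  exact Measure.ae_ae_of_ae_prod hω

lemma jumpEnergy_congr (hq : JumpQuasiInvariant ν μ) {F F' : CadlagPath T d → ℝ}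
    (h : F =ᵐ[μ] F') : jumpEnergy ν μ F = jumpEnergy ν μ F' := by
  rw [jumpEnergy, jumpEnergy]
  congr 1
  refine lintegral_congr_ae ?_
  filter_upwards [ae_ae_ae_of_ae_jumpMeasure (jumpDiff_congr hq h)] with ω hω
  refine lintegral_congr_ae ?_
  filter_upwards [hω] with t ht
  refine lintegral_congr_ae ?_
  filter_upwards [ht] with x hx
  exact congrArg ENNReal.ofReal (congrArg₂ (· * ·) hx hx)

lemma jumpForm_congr (hq : JumpQuasiInvariant ν μ) {F F' G G' : CadlagPath T d → ℝ}
    (h : F =ᵐ[μ] F') (h' : G =ᵐ[μ] G') : jumpForm ν μ F G = jumpForm ν μ F' G' := by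
  rw [jumpForm, jumpForm]
  congr 1
  refine integral_congr_ae ?_
  filter_upwards [ae_ae_ae_of_ae_jumpMeasure (jumpDiff_congr hq h),
    ae_ae_ae_of_ae_jumpMeasure (jumpDiff_congr hq h')] with ω hω hω'
  refine integral_congr_ae ?_
  filter_upwards [hω, hω'] with t ht ht'
  refine integral_congr_ae ?_
  filter_upwards [ht, ht'] with x hx hx'
  exact congrArg₂ (· * ·) hx hx'

lemma jumpEnergy_eq {F : CadlagPath T d → ℝ} (hF : Measurable F) :
    jumpEnergy ν μ F
      = ENNReal.ofReal T⁻¹ * ∫⁻ p, ENNReal.ofReal (jumpDiff F p ^ 2) ∂(jumpMeasure ν μ) := by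
  have hm : Measurable fun p => ENNReal.ofReal (jumpDiff F p ^ 2) :=
    (hF.jumpDiff.pow_const 2).ennreal_ofReal
  rw [jumpEnergy, jumpMeasure, lintegral_prod _ hm.aemeasurable]
  congr 1
  refine lintegral_congr fun ω => ?_
  rw [lintegral_prod (fun q => ENNReal.ofReal (jumpDiff F (ω, q) ^ 2))
    (hm.comp measurable_prodMk_left).aemeasurable]
  simp only [jumpGamma, jumpDiff, sq]

lemma jumpEnergy_lt_top_iff (hT : 0 < T) {F : CadlagPath T d → ℝ} (hF : Measurable F) :
    jumpEnergy ν μ F < ⊤ ↔ MemLp (jumpDiff F) 2 (jumpMeasure ν μ) := by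
  rw [memLp_two_iff_integrable_sq hF.jumpDiff.aestronglyMeasurable, jumpEnergy_eq hF, Integrable,
    hasFiniteIntegral_iff_ofReal (Eventually.of_forall fun p => sq_nonneg _),
    and_iff_right (hF.jumpDiff.pow_const 2).aestronglyMeasurable]
  have h1 : ENNReal.ofReal T⁻¹ ≠ 0 := by
    rw [Ne, ENNReal.ofReal_eq_zero, not_le]
    exact inv_pos.2 hT
  constructor
  · intro h
    exact (ENNReal.mul_lt_top_iff.1 h).elim (fun h => h.2) fun h =>
      h.elim (fun h => absurd h h1) fun h => h ▸ ENNReal.zero_lt_top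
  · exact fun h => ENNReal.mul_lt_top ENNReal.ofReal_lt_top h

lemma mem_jumpDomain_iff (hT : 0 < T) {u : Lp ℝ 2 μ} :
    u ∈ jumpDomain ν μ ↔ MemLp (jumpDiff u) 2 (jumpMeasure ν μ) :=
  jumpEnergy_lt_top_iff hT (measurable_coe_Lp u)

/-- The increment of an element of the domain as an element of `L²`. -/
noncomputable def jumpDiffLp (hT : 0 < T) {u : Lp ℝ 2 μ} (hu : u ∈ jumpDomain ν μ) :
    Lp ℝ 2 (jumpMeasure ν μ) :=
  ((mem_jumpDomain_iff hT).1 hu).toLp _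

lemma sub_mem_jumpDomain (hT : 0 < T) (hq : JumpQuasiInvariant ν μ) {u v : Lp ℝ 2 μ}
    (hu : u ∈ jumpDomain ν μ) (hv : v ∈ jumpDomain ν μ) : u - v ∈ jumpDomain ν μ := by
  rw [mem_jumpDomain_iff hT] at *
  exact (hu.sub hv).ae_eq (jumpDiff_sub hq u v).symm

/-- The increment operator is closed. -/
lemma jumpDiff_ae_eq_of_tendsto (hT : 0 < T) (hq : JumpQuasiInvariant ν μ) {u : ℕ → Lp ℝ 2 μ}
    (hu : ∀ n, u n ∈ jumpDomain ν μ) {v : Lp ℝ 2 μ} (hv : Tendsto u atTop (𝓝 v))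
    {W : Lp ℝ 2 (jumpMeasure ν μ)}
    (hW : Tendsto (fun n => jumpDiffLp hT (hu n)) atTop (𝓝 W)) :
    jumpDiff v =ᵐ[jumpMeasure ν μ] W := by
  -- The second subsequence is taken inside the first, so that both limits hold almost everywhere
  -- along it; `hq.ae` carries the convergence to the shifted paths.
  obtain ⟨φ, hφ, h1⟩ := (tendstoInMeasure_of_tendsto_Lp hv).exists_seq_tendsto_ae
  obtain ⟨ψ, hψ, h2⟩ :=
    (tendstoInMeasure_of_tendsto_Lp (hW.comp hφ.tendsto_atTop)).exists_seq_tendsto_ae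
  have h3 : ∀ᵐ p ∂(jumpMeasure ν μ), ∀ n, jumpDiffLp hT (hu n) p = jumpDiff (u n) p :=
    ae_all_iff.2 fun n => ((mem_jumpDomain_iff hT).1 (hu n)).coeFn_toLp
  filter_upwards [hq.ae h1, Measure.quasiMeasurePreserving_fst.ae h1, h2, h3] with p p1 p2 p3 p4
  refine tendsto_nhds_unique ?_ p3
  simp only [Function.comp_apply, p4]
  exact (p1.sub p2).comp hψ.tendsto_atTop

variable [IsProbabilityMeasure μ]

instance : IsFiniteMeasure (jumpMeasure ν μ) := by
  unfold jumpMeasure; infer_instance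

lemma jumpForm_eq {F G : CadlagPath T d → ℝ} (hF : MemLp (jumpDiff F) 2 (jumpMeasure ν μ))
    (hG : MemLp (jumpDiff G) 2 (jumpMeasure ν μ)) :
    jumpForm ν μ F G = T⁻¹ * ∫ p, jumpDiff F p * jumpDiff G p ∂(jumpMeasure ν μ) := by
  have hi : Integrable (fun p => jumpDiff F p * jumpDiff G p) (jumpMeasure ν μ) :=
    hF.integrable_mul hG
  rw [jumpForm, jumpMeasure, integral_prod _ hi]
  congr 1
  refine integral_congr_ae ?_
  filter_upwards [hi.prod_right_ae] with ω hω
  rw [integral_prod _ hω]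
  rfl

lemma memLp_jumpDiff_of_bounded {F : CadlagPath T d → ℝ} (hF : Measurable F) {K : ℝ}
    (hK : ∀ ω, |F ω| ≤ K) : MemLp (jumpDiff F) 2 (jumpMeasure ν μ) :=
  MemLp.of_bound hF.jumpDiff.aestronglyMeasurable (2 * K)
    (Eventually.of_forall fun _ => abs_sub_le_two_mul (hK _) (hK _))

/-- Simple functions are bounded, hence have bounded jump differences over a finite measure. -/
lemma dense_jumpDomain (hT : 0 < T) (hq : JumpQuasiInvariant ν μ) :
    Dense (jumpDomain ν μ) := by
  refine (Lp.simpleFunc.denseRange (E := ℝ) (μ := μ) (p := 2) (by norm_num)).mono ?_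
  rintro _ ⟨f, rfl⟩
  rw [mem_jumpDomain_iff hT]
  obtain ⟨K, hK⟩ := (Lp.simpleFunc.toSimpleFunc f).exists_forall_norm_le
  exact (memLp_jumpDiff_of_bounded (Lp.simpleFunc.toSimpleFunc f).measurable hK).ae_eq
    (jumpDiff_congr hq (Lp.simpleFunc.toSimpleFunc_eq_toFun f))

lemma jumpForm_self_eq_norm (hT : 0 < T) {u : Lp ℝ 2 μ} (hu : u ∈ jumpDomain ν μ) :
    jumpForm ν μ u u = T⁻¹ * ‖jumpDiffLp hT hu‖ ^ 2 := by
  rw [jumpForm_eq ((mem_jumpDomain_iff hT).1 hu) ((mem_jumpDomain_iff hT).1 hu),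
    ← real_inner_self_eq_norm_sq, L2.inner_def]
  congr 1
  refine integral_congr_ae ?_
  filter_upwards [((mem_jumpDomain_iff hT).1 hu).coeFn_toLp] with p hp
  have hp' : jumpDiffLp hT hu p = jumpDiff u p := hp
  rw [hp']
  simp [sq]

lemma jumpForm_sub_self_eq_norm (hT : 0 < T) (hq : JumpQuasiInvariant ν μ) {u v : Lp ℝ 2 μ}
    (hu : u ∈ jumpDomain ν μ) (hv : v ∈ jumpDomain ν μ) :
    jumpForm ν μ (u - v : Lp ℝ 2 μ) (u - v : Lp ℝ 2 μ)
      = T⁻¹ * ‖jumpDiffLp hT hu - jumpDiffLp hT hv‖ ^ 2 := by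
  rw [jumpForm_self_eq_norm hT (sub_mem_jumpDomain hT hq hu hv)]
  have : jumpDiffLp hT (sub_mem_jumpDomain hT hq hu hv) = jumpDiffLp hT hu - jumpDiffLp hT hv := by
    rw [jumpDiffLp, jumpDiffLp, jumpDiffLp, ← MemLp.toLp_sub]
    exact MemLp.toLp_congr _ _ (jumpDiff_sub hq u v)
  rw [this]

/-- A sequence that is Cauchy for the form norm converges in `L²` together with its jump
differences; closedness of the difference operator identifies the second limit. -/
lemma jumpForm_complete (hT : 0 < T) (hq : JumpQuasiInvariant ν μ) (u : ℕ → Lp ℝ 2 μ)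
    (hu : ∀ n, u n ∈ jumpDomain ν μ)
    (hc : ∀ ε > 0, ∃ N, ∀ m ≥ N, ∀ n ≥ N,
      jumpForm ν μ (u m - u n : Lp ℝ 2 μ) (u m - u n : Lp ℝ 2 μ) + ‖u m - u n‖ ^ 2 < ε) :
    ∃ v ∈ jumpDomain ν μ, Tendsto (fun n =>
      jumpForm ν μ (u n - v : Lp ℝ 2 μ) (u n - v : Lp ℝ 2 μ) + ‖u n - v‖ ^ 2) atTop (𝓝 0) := by
  have hT' : 0 < T⁻¹ := inv_pos.2 hT
  have hcu : CauchySeq u := by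
    refine Metric.cauchySeq_iff.2 fun ε hε => ?_
    obtain ⟨N, hN⟩ := hc (ε ^ 2) (by positivity)
    refine ⟨N, fun m hm n hn => ?_⟩
    have h := hN m hm n hn
    rw [jumpForm_sub_self_eq_norm hT hq (hu m) (hu n)] at h
    rw [dist_eq_norm]
    refine lt_of_pow_lt_pow_left₀ 2 hε.le (lt_of_le_of_lt ?_ h)
    have : 0 ≤ T⁻¹ * ‖jumpDiffLp hT (hu m) - jumpDiffLp hT (hu n)‖ ^ 2 := by positivity
    linarith
  have hcd : CauchySeq fun n => jumpDiffLp hT (hu n) := by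
    refine Metric.cauchySeq_iff.2 fun ε hε => ?_
    obtain ⟨N, hN⟩ := hc (T⁻¹ * ε ^ 2) (by positivity)
    refine ⟨N, fun m hm n hn => ?_⟩
    have h := hN m hm n hn
    rw [jumpForm_sub_self_eq_norm hT hq (hu m) (hu n)] at h
    rw [dist_eq_norm]
    refine lt_of_pow_lt_pow_left₀ 2 hε.le (lt_of_mul_lt_mul_left (lt_of_le_of_lt ?_ h) hT'.le)
    have : 0 ≤ ‖u m - u n‖ ^ 2 := by positivity
    linarith
  obtain ⟨v, hv⟩ := cauchySeq_tendsto_of_complete hcu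
  obtain ⟨W, hW⟩ := cauchySeq_tendsto_of_complete hcd
  have hvW := jumpDiff_ae_eq_of_tendsto hT hq hu hv hW
  have hvD : v ∈ jumpDomain ν μ := (mem_jumpDomain_iff hT).2 ((Lp.memLp W).ae_eq hvW.symm)
  have hWv : jumpDiffLp hT hvD = W := by
    refine Lp.ext ?_
    filter_upwards [((mem_jumpDomain_iff hT).1 hvD).coeFn_toLp, hvW] with p h1 h2
    exact h1.trans h2
  refine ⟨v, hvD, ?_⟩
  have h1 : Tendsto (fun n => ‖u n - v‖ ^ 2) atTop (𝓝 0) := by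
    simpa using ((tendsto_iff_norm_sub_tendsto_zero.1 hv).pow 2)
  have h2 : Tendsto (fun n => T⁻¹ * ‖jumpDiffLp hT (hu n) - W‖ ^ 2) atTop (𝓝 0) := by
    simpa using ((tendsto_iff_norm_sub_tendsto_zero.1 hW).pow 2).const_mul T⁻¹
  have h3 := h2.add h1
  rw [add_zero] at h3
  refine h3.congr fun n => ?_
  rw [jumpForm_sub_self_eq_norm hT hq (hu n) hvD, hWv]

lemma abs_unitContraction_sub_le (a b : ℝ) :
    |min (max a 0) 1 - min (max b 0) 1| ≤ |a - b| :=
  (abs_min_sub_min_le_max _ _ _ _).trans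
    (max_le ((abs_max_sub_max_le_abs _ _ _)) (by simp))

lemma jumpForm_markov (hT : 0 < T) (hq : JumpQuasiInvariant ν μ) {u v : Lp ℝ 2 μ}
    (hu : u ∈ jumpDomain ν μ) (huv : ∀ᵐ a ∂μ, v a = min (max (u a) 0) 1) :
    v ∈ jumpDomain ν μ ∧ jumpForm ν μ v v ≤ jumpForm ν μ u u := by
  have hle : ∀ᵐ p ∂(jumpMeasure ν μ), |jumpDiff v p| ≤ |jumpDiff u p| := by
    filter_upwards [jumpDiff_congr hq huv] with p hp
    rw [hp]
    exact abs_unitContraction_sub_le _ _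
  have hu' := (mem_jumpDomain_iff hT).1 hu
  have hv' : MemLp (jumpDiff v) 2 (jumpMeasure ν μ) :=
    hu'.mono (measurable_coe_Lp v).jumpDiff.aestronglyMeasurable hle
  refine ⟨(mem_jumpDomain_iff hT).2 hv', ?_⟩
  rw [jumpForm_eq hu' hu', jumpForm_eq hv' hv']
  refine mul_le_mul_of_nonneg_left (integral_mono_ae (hv'.integrable_mul hv')
    (hu'.integrable_mul hu') ?_) (inv_nonneg.2 hT.le)
  filter_upwards [hle] with p hp
  exact abs_le_iff_mul_self_le.1 hp

theorem isSymmetricDirichletForm_jumpForm (hT : 0 < T) (hq : JumpQuasiInvariant ν μ) :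
    IsSymmetricDirichletForm (jumpDomain ν μ) (fun F G : Lp ℝ 2 μ => jumpForm ν μ F G) where
  zero_mem := (mem_jumpDomain_iff hT).2
    (MemLp.zero.ae_eq (jumpDiff_const hq (Lp.coeFn_zero ℝ 2 μ)).symm)
  add_mem u hu v hv := by
    rw [mem_jumpDomain_iff hT] at *
    exact (hu.add hv).ae_eq (jumpDiff_add hq u v).symm
  smul_mem c u hu := by
    rw [mem_jumpDomain_iff hT] at *
    exact (hu.const_smul c).ae_eq (jumpDiff_smul hq c u).symm
  dense := dense_jumpDomain hT hq
  symm u hu v hv := by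
    rw [mem_jumpDomain_iff hT] at *
    rw [jumpForm_eq hu hv, jumpForm_eq hv hu]
    simp only [mul_comm]
  add_left u hu v hv w hw := by
    rw [mem_jumpDomain_iff hT] at *
    have huv := jumpDiff_add hq u v
    have h1 : Integrable (fun p => jumpDiff u p * jumpDiff w p) (jumpMeasure ν μ) :=
      hu.integrable_mul hw
    have h2 : Integrable (fun p => jumpDiff v p * jumpDiff w p) (jumpMeasure ν μ) :=
      hv.integrable_mul hw
    rw [jumpForm_eq hu hw, jumpForm_eq hv hw, jumpForm_eq ((hu.add hv).ae_eq huv.symm) hw,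
      ← mul_add, ← integral_add h1 h2]
    congr 1
    refine integral_congr_ae ?_
    filter_upwards [huv] with p hp
    rw [hp]
    simp [add_mul]
  smul_left c u hu v hv := by
    rw [mem_jumpDomain_iff hT] at *
    have hcu := jumpDiff_smul hq c u
    rw [jumpForm_eq hu hv, jumpForm_eq ((hu.const_smul c).ae_eq hcu.symm) hv, mul_left_comm,
      ← integral_const_mul c]
    congr 1
    refine integral_congr_ae ?_
    filter_upwards [hcu] with p hp
    rw [hp]
    simp [mul_assoc]
  nonneg u hu := by
    rw [jumpForm_self_eq_norm hT hu]
    positivity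
  complete := jumpForm_complete hT hq
  markov u hu v huv := jumpForm_markov hT hq hu huv

/-- A contraction semigroup fixes every element killed by its generator. -/
lemma semigroup_apply_eq_self {H : Type*} [NormedAddCommGroup H] [NormedSpace ℝ H]
    {P : ℝ≥0 → H →L[ℝ] H} (hadd : ∀ s t u, P (s + t) u = P s (P t u))
    (hcontr : ∀ t u, ‖P t u‖ ≤ ‖u‖) (hzero : ∀ u, P 0 u = u) {u : H}
    (hgen : Tendsto (fun t : ℝ≥0 => (t : ℝ)⁻¹ • (P t u - u)) (𝓝[>] 0) (𝓝 0)) (t : ℝ≥0) :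
    P t u = u := by
  rcases eq_or_ne t 0 with rfl | ht
  · exact hzero u
  replace ht := pos_iff_ne_zero.2 ht
  -- Telescoping over `n` steps of length `s`, each contracted. With `s = t / n` the bound is `t`
  -- times the norm of a difference quotient, which tends to zero.
  have hn : ∀ (s : ℝ≥0) (n : ℕ), ‖P (n * s) u - u‖ ≤ n * ‖P s u - u‖ := by
    intro s n
    induction n with
    | zero => simp [hzero]
    | succ n ih =>
      have : P ((n + 1 : ℕ) * s) u - u = P (n * s) (P s u - u) + (P (n * s) u - u) := by
        rw [map_sub, ← hadd]
        push_cast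
        rw [add_mul, one_mul]
        abel
      rw [this]
      push_cast
      linarith [norm_add_le (P (n * s) (P s u - u)) (P (n * s) u - u), hcontr (n * s) (P s u - u)]
  have hseq : Tendsto (fun n : ℕ => t / ((n : ℝ≥0) + 1)) atTop (𝓝[>] 0) := by
    refine tendsto_nhdsWithin_iff.2 ⟨?_, Eventually.of_forall fun n => ?_⟩
    · have := (tendsto_one_div_add_atTop_nhds_zero_nat (𝕜 := ℝ)).const_mul (t : ℝ)
      rw [← NNReal.tendsto_coe]
      simpa [div_eq_mul_inv] using this
    · exact div_pos ht (by positivity)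
  have h1 := ((hgen.comp hseq).norm).const_mul (t : ℝ)
  rw [norm_zero, mul_zero] at h1
  have h2 : ‖P t u - u‖ ≤ 0 := by
    refine ge_of_tendsto' h1 fun n => ?_
    have h3 := hn (t / ((n : ℝ≥0) + 1)) (n + 1)
    have h4 : ((n + 1 : ℕ) : ℝ≥0) * (t / ((n : ℝ≥0) + 1)) = t := by
      push_cast
      field_simp
    rw [h4] at h3
    refine h3.trans (le_of_eq ?_)
    have ht' : (t : ℝ) ≠ 0 := by exact_mod_cast ht.ne'
    rw [Function.comp_apply, norm_smul, norm_inv, NNReal.norm_eq]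
    push_cast
    field_simp
  exact sub_eq_zero.1 (norm_le_zero_iff.1 h2)

theorem isConservative_jumpForm (hT : 0 < T) (hq : JumpQuasiInvariant ν μ) :
    IsConservative (jumpDomain ν μ) (fun F G : Lp ℝ 2 μ => jumpForm ν μ F G) := by
  have h0 : jumpDiff (Lp.const 2 μ (1 : ℝ)) =ᵐ[jumpMeasure ν μ] 0 :=
    jumpDiff_const hq (c := 1) (Lp.coeFn_const 2 μ (1 : ℝ))
  have h1 : MemLp (jumpDiff (Lp.const 2 μ (1 : ℝ))) 2 (jumpMeasure ν μ) :=
    MemLp.zero.ae_eq h0.symm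
  have hone : Lp.const 2 μ (1 : ℝ) ∈ jumpDomain ν μ := (mem_jumpDomain_iff hT).2 h1
  have hform : ∀ v ∈ jumpDomain ν μ, jumpForm ν μ (Lp.const 2 μ (1 : ℝ)) v = 0 := by
    intro v hv
    rw [jumpForm_eq h1 ((mem_jumpDomain_iff hT).1 hv),
      integral_eq_zero_of_ae (h0.mono fun p hp => ?_), mul_zero]
    exact mul_eq_zero_of_left hp _
  refine ⟨hone, hform, fun P hP => semigroup_apply_eq_self hP.add hP.contraction hP.zero ?_⟩
  exact (hP.generator _ 0).2 ⟨hone, fun v hv => by rw [hform v hv]; simp⟩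

end JumpFormTheory

/-! ### Quasi-invariance, the Poincaré inequality and the failure of log-Sobolev on path space. -/

section CompoundPoissonPaths

variable {T : ℝ} {d : ℕ} {ν : Measure (EuclideanSpace ℝ (Fin d))}

/-- The event that the positions at times `z` and `s` differ. -/
def movesBefore (z s : Set.Icc (0 : ℝ) T) : Set (CadlagPath T d) := {ω | ω s - ω z ∈ ({0}ᶜ : Set _)}

lemma measurableSet_movesBefore (z s : Set.Icc (0 : ℝ) T) :
    MeasurableSet (movesBefore z s : Set (CadlagPath T d)) :=
  ((CadlagPath.measurable_eval s).sub (CadlagPath.measurable_eval z))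
    (measurableSet_singleton 0).compl

lemma measureReal_movesBefore {Ω : Type*} [MeasurableSpace Ω] {P : Measure Ω}
    {X : Ω → CadlagPath T d} (hX : IsPoissonProcess ν P X) {μ : Measure (CadlagPath T d)}
    (hμ : HasLaw X μ P) {z s : Set.Icc (0 : ℝ) T} (hzs : z ≤ s) :
    μ.real (movesBefore z s) = (compoundPoissonLaw ((s : ℝ) - z).toNNReal ν).real {0}ᶜ := by
  rw [← compoundPoisson_eq_compoundPoissonLaw, ← (hX.increments z s hzs).map_eq, ← hμ.map_eq,
    map_measureReal_apply_of_aemeasurable hμ.aemeasurable (measurableSet_movesBefore z s),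
    map_measureReal_apply_of_aemeasurable (hX.increments z s hzs).aemeasurable
      (measurableSet_singleton 0).compl]
  rfl

/-- A jump after time `s` changes neither position, and an indicator times `c` changes by at most
`|c|`. -/
lemma jumpDiff_movesBefore_sq_le {z s : Set.Icc (0 : ℝ) T} (hzs : z ≤ s) (c : ℝ)
    (p : CadlagPath T d × ℝ × EuclideanSpace ℝ (Fin d)) :
    jumpDiff ((movesBefore z s).indicator fun _ => c) p *
        jumpDiff ((movesBefore z s).indicator fun _ => c) p
      ≤ (Set.univ ×ˢ (Set.Iic (s : ℝ) ×ˢ Set.univ)).indicator (fun _ => c ^ 2) p := by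
  obtain ⟨ω, t, x⟩ := p
  by_cases ht : t ≤ s
  · rw [Set.indicator_of_mem (by simp [ht])]
    rw [jumpDiff]
    by_cases h1 : ω.addJump t x ∈ (movesBefore z s : Set (CadlagPath T d)) <;>
      by_cases h2 : ω ∈ (movesBefore z s : Set (CadlagPath T d)) <;>
      simp [h1, h2, ← sq, sq_nonneg]
  · have hz : ¬ t ≤ z := fun h => ht (h.trans hzs)
    have h1 : ω.addJump t x ∈ (movesBefore z s : Set (CadlagPath T d)) ↔ ω ∈ movesBefore z s := by
      simp only [movesBefore, Set.mem_ofPred_eq, CadlagPath.addJump_eq, CadlagPath.add_apply,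
        CadlagPath.jump_apply, if_neg ht, if_neg hz, add_zero]
    have h2 : jumpDiff ((movesBefore z s).indicator fun _ => c) (ω, t, x) = 0 := by
      rw [jumpDiff]
      by_cases h2 : ω ∈ (movesBefore z s : Set (CadlagPath T d))
      · rw [Set.indicator_of_mem h2, Set.indicator_of_mem (h1.2 h2), sub_self]
      · rw [Set.indicator_of_notMem h2, Set.indicator_of_notMem (mt h1.1 h2), sub_self]
    rw [h2, mul_zero]
    exact Set.indicator_nonneg (fun _ _ => sq_nonneg c) _

variable [IsProbabilityMeasure ν]

/-- The Mecke formula implies that adding a jump does not charge null sets. -/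
theorem jumpQuasiInvariant_compoundPoissonLaw (hT : 0 < T) :
    JumpQuasiInvariant ν (compoundPoissonLaw T.toNNReal (CadlagPath.jumpLaw T ν)) := by
  have := CadlagPath.isProbabilityMeasure_jumpLaw hT ν
  refine ⟨measurable_addJump, ?_⟩
  set μ := compoundPoissonLaw T.toNNReal (CadlagPath.jumpLaw T ν) with hμ
  have h1 : (jumpMeasure ν μ).map (fun p => p.1.addJump p.2.1 p.2.2)
      = μ.conv (((volume.restrict (Set.Icc 0 T)).prod ν).map fun p => CadlagPath.jump p.1 p.2) := by
    have h2 := Measure.map_prod_map μ ((volume.restrict (Set.Icc 0 T)).prod ν) measurable_id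
      (CadlagPath.measurable_jump (T := T) (d := d))
    rw [Measure.conv, ← Measure.map_id (μ := μ), h2, Measure.map_map measurable_add
      (measurable_id.prodMap CadlagPath.measurable_jump), Measure.map_id, jumpMeasure]
    congr 1
    funext p
    exact CadlagPath.addJump_eq _ _ _
  -- Lebesgue time and uniform time differ by a positive factor, so they have the same null sets.
  have hac : ((volume.restrict (Set.Icc 0 T)).prod ν).map
      (fun p => (CadlagPath.jump p.1 p.2 : CadlagPath T d)) ≪ CadlagPath.jumpLaw T ν := by
    rw [CadlagPath.jumpLaw_eq_smul]
    refine Measure.absolutelyContinuous_smul ?_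
    rw [Ne, ENNReal.ofReal_eq_zero, not_le]
    exact inv_pos.2 hT
  rw [h1]
  refine Measure.AbsolutelyContinuous.trans ?_
    (conv_compoundPoissonLaw_absolutelyContinuous (Real.toNNReal_pos.2 hT))
  exact (Measure.AbsolutelyContinuous.rfl.prod hac).map measurable_add

/-- The density of the uniform jump time accounts for the `T⁻¹` of the form; the Poincaré constant
`T` is then the jump rate. -/
lemma integral_prod_jumpLaw (hT : 0 < T) {μ : Measure (CadlagPath T d)} [IsProbabilityMeasure μ]
    {F : CadlagPath T d → ℝ} (hF : Measurable F) :
    ∫ p : CadlagPath T d × CadlagPath T d, (F (p.1 + p.2) - F p.1) ^ 2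
        ∂(μ.prod (CadlagPath.jumpLaw T ν))
      = T⁻¹ * ∫ p, jumpDiff F p * jumpDiff F p ∂(jumpMeasure ν μ) := by
  have hm : Measurable fun p : CadlagPath T d × CadlagPath T d => (F (p.1 + p.2) - F p.1) ^ 2 :=
    ((hF.comp measurable_add).sub (hF.comp measurable_fst)).pow_const 2
  have h2 := Measure.map_prod_map μ ((volume.restrict (Set.Icc 0 T)).prod ν) measurable_id
    (CadlagPath.measurable_jump (T := T) (d := d))
  rw [Measure.map_id] at h2
  rw [CadlagPath.jumpLaw_eq_smul, Measure.prod_smul_right, integral_smul_measure, h2,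
    integral_map (measurable_id.prodMap CadlagPath.measurable_jump).aemeasurable
      hm.aestronglyMeasurable, ENNReal.toReal_ofReal (inv_nonneg.2 hT.le), smul_eq_mul, jumpMeasure]
  congr 1
  refine integral_congr_ae (Eventually.of_forall fun p => ?_)
  simp only [jumpDiff, CadlagPath.addJump_eq, Prod.map_fst, Prod.map_snd, id, sq]

theorem jumpForm_poincare (hT : 0 < T) {μ : Measure (CadlagPath T d)} [IsProbabilityMeasure μ]
    (hμ : μ = compoundPoissonLaw T.toNNReal (CadlagPath.jumpLaw T ν)) {u : Lp ℝ 2 μ}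
    (hu : u ∈ jumpDomain ν μ) :
    ∫ ω, u ω ^ 2 ∂μ ≤ T * jumpForm ν μ u u + (∫ ω, u ω ∂μ) ^ 2 := by
  have := CadlagPath.isProbabilityMeasure_jumpLaw hT ν
  have hm := measurable_coe_Lp u
  have hu' := (mem_jumpDomain_iff hT).1 hu
  have hint : Integrable (fun p : CadlagPath T d × CadlagPath T d => (u (p.1 + p.2) - u p.1) ^ 2)
      (μ.prod (CadlagPath.jumpLaw T ν)) := by
    have hmp : Measurable fun p : CadlagPath T d × CadlagPath T d => (u (p.1 + p.2) - u p.1) ^ 2 :=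
      ((hm.comp measurable_add).sub (hm.comp measurable_fst)).pow_const 2
    have h2 := Measure.map_prod_map μ ((volume.restrict (Set.Icc 0 T)).prod ν) measurable_id
      (CadlagPath.measurable_jump (T := T) (d := d))
    rw [Measure.map_id] at h2
    rw [CadlagPath.jumpLaw_eq_smul, Measure.prod_smul_right, h2]
    refine Integrable.smul_measure ?_ ENNReal.ofReal_ne_top
    refine (integrable_map_measure hmp.aestronglyMeasurable
      (measurable_id.prodMap CadlagPath.measurable_jump).aemeasurable).2 ?_
    refine hu'.integrable_sq.congr (Eventually.of_forall fun p => ?_)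
    simp only [jumpDiff, CadlagPath.addJump_eq, Function.comp_apply, Prod.map_fst, Prod.map_snd, id]
  have hmem := Lp.memLp u
  have h := compoundPoissonLaw_poincare (ρ := CadlagPath.jumpLaw T ν) T.toNNReal hm (hμ ▸ hmem)
    (hμ ▸ hint)
  rwa [← hμ, integral_prod_jumpLaw hT hm, ← jumpForm_eq hu' hu', Real.coe_toNNReal _ hT.le] at h

/-- Without jumps the value is `0`, and `1 - e^{-r} ≤ r`. -/
lemma compoundPoissonLaw_compl_zero_le {E : Type*} [NormedAddCommGroup E] [MeasurableSpace E]
    [BorelSpace E] [SecondCountableTopology E] (r : ℝ≥0) (ρ : Measure E) [IsProbabilityMeasure ρ] :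
    (compoundPoissonLaw r ρ).real {0}ᶜ ≤ r := by
  have h0 : MeasurableSet ({0} : Set E) := measurableSet_singleton 0
  have h1 : Real.exp (-r) ≤ (compoundPoissonLaw r ρ).real {0} := by
    have h2 := Measure.le_sum_apply (fun n => poissonMeasure r {n} • addConvPow ρ n) {0}
    have h3 := ENNReal.le_tsum (f := fun n => (poissonMeasure r {n} • addConvPow ρ n) {0}) 0
    have h4 := ENNReal.toReal_mono (measure_ne_top (compoundPoissonLaw r ρ) {0}) (h3.trans h2)
    have h5 : (poissonMeasure r {0} • addConvPow ρ 0) {(0 : E)}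
        = ENNReal.ofReal (Real.exp (-r)) := by
      rw [Measure.smul_apply, addConvPow, Measure.dirac_apply' _ h0, poissonMeasure_singleton]
      simp
    rw [h5, ENNReal.toReal_ofReal (Real.exp_nonneg _)] at h4
    exact h4
  rw [probReal_compl_eq_one_sub h0]
  linarith [Real.add_one_le_exp (-(r : ℝ))]

/-- Only the event of exactly one jump is counted: that jump is nonzero by `hρ`, whereas several
jumps might cancel. -/
lemma le_compoundPoissonLaw_compl_zero {E : Type*} [NormedAddCommGroup E] [MeasurableSpace E]
    [BorelSpace E] [SecondCountableTopology E] (r : ℝ≥0) (ρ : Measure E) [IsProbabilityMeasure ρ]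
    (hρ : ρ {0} = 0) :
    Real.exp (-r) * r ≤ (compoundPoissonLaw r ρ).real {0}ᶜ := by
  have h0 : MeasurableSet ({0} : Set E) := measurableSet_singleton 0
  have h2 := Measure.le_sum_apply (fun n => poissonMeasure r {n} • addConvPow ρ n) {0}ᶜ
  have h3 := ENNReal.le_tsum (f := fun n => (poissonMeasure r {n} • addConvPow ρ n) {0}ᶜ) 1
  have h4 := ENNReal.toReal_mono (measure_ne_top (compoundPoissonLaw r ρ) {0}ᶜ) (h3.trans h2)
  have h5 : (poissonMeasure r {1} • addConvPow ρ 1) {(0 : E)}ᶜ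
      = ENNReal.ofReal (Real.exp (-r) * r) := by
    rw [Measure.smul_apply, addConvPow, addConvPow, Measure.dirac_zero_conv,
      prob_compl_eq_one_sub h0, hρ, poissonMeasure_singleton]
    simp
  rw [h5, ENNReal.toReal_ofReal (by positivity)] at h4
  exact h4

/-- The entropy of suitable normalized indicators is not controlled by the form. -/
theorem exists_jumpForm_lt_entropy (hT : 0 < T) (hν : ν {0} = 0) {Ω : Type*} [MeasurableSpace Ω]
    {P : Measure Ω} {X : Ω → CadlagPath T d} (hX : IsPoissonProcess ν P X)
    {μ : Measure (CadlagPath T d)} [IsProbabilityMeasure μ] (hμ : HasLaw X μ P)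
    (hq : JumpQuasiInvariant ν μ) {C : ℝ} (hC : 0 < C) :
    ∃ F ∈ jumpDomain ν μ, ∫ ω, F ω ^ 2 ∂μ = 1 ∧
      Integrable (fun ω => F ω ^ 2 * Real.log (F ω ^ 2)) μ ∧
      C * jumpForm ν μ F F < ∫ ω, F ω ^ 2 * Real.log (F ω ^ 2) ∂μ := by
  -- `T⁻¹ e^T` bounds the energy uniformly in `h`; the choice `h ≤ e^{-(K + 1)}` then forces the
  -- entropy above `K`.
  let K : ℝ := C * (T⁻¹ * Real.exp T)
  obtain ⟨h, hh0, hhT, hhK⟩ : ∃ h : ℝ, 0 < h ∧ h ≤ T ∧ h ≤ Real.exp (-(K + 1)) :=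
    ⟨min T (Real.exp (-(K + 1))), lt_min hT (Real.exp_pos _), min_le_left _ _, min_le_right _ _⟩
  let z : Set.Icc (0 : ℝ) T := ⟨0, le_rfl, hT.le⟩
  let s : Set.Icc (0 : ℝ) T := ⟨h, hh0.le, hhT⟩
  have hzs : z ≤ s := hh0.le
  let A : Set (CadlagPath T d) := movesBefore z s
  have hA : MeasurableSet A := measurableSet_movesBefore z s
  let p : ℝ := μ.real A
  have hpeq : p = (compoundPoissonLaw h.toNNReal ν).real {0}ᶜ := by
    have := measureReal_movesBefore hX hμ hzs
    rwa [show ((s : ℝ) - z) = h from sub_zero h] at this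
  have hple : p ≤ h := by
    rw [hpeq]
    exact (compoundPoissonLaw_compl_zero_le _ ν).trans (Real.coe_toNNReal h hh0.le).le
  have hlep : Real.exp (-h) * h ≤ p := by
    have := le_compoundPoissonLaw_compl_zero h.toNNReal ν hν
    rwa [Real.coe_toNNReal h hh0.le, ← hpeq] at this
  have hp0 : 0 < p := lt_of_lt_of_le (by positivity) hlep
  let c : ℝ := √p⁻¹
  have hc : c ^ 2 = p⁻¹ := Real.sq_sqrt (inv_nonneg.2 hp0.le)
  let f : CadlagPath T d → ℝ := A.indicator fun _ => c
  have hf : Measurable f := measurable_const.indicator hA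
  have hfb : ∀ ω, |f ω| ≤ c := fun ω => by
    by_cases hω : ω ∈ A <;> simp [f, hω, c, abs_of_nonneg (Real.sqrt_nonneg p)]
  let F : Lp ℝ 2 μ := indicatorConstLp 2 hA (measure_ne_top μ A) c
  have hF : F =ᵐ[μ] f := indicatorConstLp_coeFn
  have hDf : MemLp (jumpDiff f) 2 (jumpMeasure ν μ) := memLp_jumpDiff_of_bounded hf hfb
  have hFD : F ∈ jumpDomain ν μ := (mem_jumpDomain_iff hT).2 (hDf.ae_eq (jumpDiff_congr hq hF).symm)
  have hsq : ∀ ω, f ω ^ 2 = A.indicator (fun _ => p⁻¹) ω := fun ω => by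
    by_cases hω : ω ∈ A <;> simp [f, hω, hc]
  have hent : (fun ω => F ω ^ 2 * Real.log (F ω ^ 2))
      =ᵐ[μ] A.indicator fun _ => p⁻¹ * Real.log p⁻¹ := by
    filter_upwards [hF] with ω hω
    rw [hω, hsq]
    by_cases hωA : ω ∈ A <;> simp [hωA]
  have henergy : jumpForm ν μ F F ≤ T⁻¹ * Real.exp T := by
    rw [jumpForm_congr hq hF hF, jumpForm_eq hDf hDf]
    refine mul_le_mul_of_nonneg_left ?_ (inv_nonneg.2 hT.le)
    let B : Set (CadlagPath T d × ℝ × EuclideanSpace ℝ (Fin d)) :=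
      Set.univ ×ˢ (Set.Iic (s : ℝ) ×ˢ Set.univ)
    have hB : MeasurableSet B := MeasurableSet.univ.prod (measurableSet_Iic.prod MeasurableSet.univ)
    have hmB : (jumpMeasure ν μ).real B = h := by
      have hI : Set.Iic h ∩ Set.Icc 0 T = Set.Icc 0 h := by
        ext t
        simp only [Set.mem_inter_iff, Set.mem_Iic, Set.mem_Icc]
        exact ⟨fun ht => ⟨ht.2.1, ht.1⟩, fun ht => ⟨ht.2, ht.1, ht.2.trans hhT⟩⟩
      rw [measureReal_def, jumpMeasure, Measure.prod_prod, Measure.prod_prod, measure_univ,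
        measure_univ, one_mul, mul_one, Measure.restrict_apply measurableSet_Iic, hI,
        Real.volume_Icc, sub_zero, ENNReal.toReal_ofReal hh0.le]
    calc ∫ q, jumpDiff f q * jumpDiff f q ∂(jumpMeasure ν μ)
        ≤ ∫ q, B.indicator (fun _ => c ^ 2) q ∂(jumpMeasure ν μ) :=
          integral_mono (hDf.integrable_mul hDf) ((integrable_const _).indicator hB)
            fun q => jumpDiff_movesBefore_sq_le hzs c q
      _ = h * p⁻¹ := by rw [integral_indicator_const _ hB, hmB, hc, smul_eq_mul]
      -- The lower bound `e^{-h} h ≤ p` makes the small factor `h` cancel the normalization `p⁻¹`.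
      _ ≤ Real.exp T := by
          rw [← div_eq_mul_inv, div_le_iff₀ hp0]
          calc h = Real.exp h * (Real.exp (-h) * h) := by
                rw [← mul_assoc, ← Real.exp_add, add_neg_cancel, Real.exp_zero, one_mul]
            _ ≤ Real.exp T * p :=
                mul_le_mul (Real.exp_le_exp.2 hhT) hlep (by positivity) (Real.exp_nonneg _)
  refine ⟨F, hFD, ?_, ((integrable_const _).indicator hA).congr hent.symm, ?_⟩
  · have : (fun ω => F ω ^ 2) =ᵐ[μ] A.indicator fun _ => p⁻¹ := by
      filter_upwards [hF] with ω hω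
      rw [hω, hsq]
    rw [integral_congr_ae this, integral_indicator_const _ hA, smul_eq_mul]
    exact mul_inv_cancel₀ hp0.ne'
  · rw [integral_congr_ae hent, integral_indicator_const _ hA, smul_eq_mul, ← mul_assoc]
    change _ < p * p⁻¹ * _
    rw [mul_inv_cancel₀ hp0.ne', one_mul, Real.log_inv]
    have h1 : Real.log p ≤ -(K + 1) := by
      rw [Real.log_le_iff_le_exp hp0]
      exact hple.trans hhK
    have h2 : C * jumpForm ν μ F F ≤ K := mul_le_mul_of_nonneg_left henergy hC.le
    linarith

end CompoundPoissonPaths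

theorem theorem1p1 (d : ℕ) (T : ℝ) (hT : 0 < T)
    (ν : Measure (EuclideanSpace ℝ (Fin d))) [IsProbabilityMeasure ν] (hν : ν {0} = 0)
    {Ω : Type*} [MeasurableSpace Ω] (P : Measure Ω) [IsProbabilityMeasure P]
    (X : Ω → CadlagPath T d) (hX : IsPoissonProcess ν P X)
    (μ : Measure (CadlagPath T d)) [IsProbabilityMeasure μ] (hμ : HasLaw X μ P) :
    -- the form does not depend on the choice of `μ`-versions
    (∀ F F' G G' : CadlagPath T d → ℝ, F =ᵐ[μ] F' → G =ᵐ[μ] G' →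
      jumpEnergy ν μ F = jumpEnergy ν μ F' ∧ jumpForm ν μ F G = jumpForm ν μ F' G') ∧
    -- the integral defining the form converges absolutely on the domain
    (∀ F ∈ jumpDomain ν μ, ∀ G ∈ jumpDomain ν μ,
      Integrable (fun p : CadlagPath T d × ℝ × EuclideanSpace ℝ (Fin d) =>
        jumpGamma p.2.1 p.2.2 F G p.1) (μ.prod ((volume.restrict (Set.Icc 0 T)).prod ν))) ∧
    -- symmetric Dirichlet form
    IsSymmetricDirichletForm (jumpDomain ν μ) (fun F G => jumpForm ν μ F G) ∧
    -- conservative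
    IsConservative (jumpDomain ν μ) (fun F G => jumpForm ν μ F G) ∧
    -- Poincaré inequality
    (∀ F ∈ jumpDomain ν μ,
      ∫ ω, F ω ^ 2 ∂μ ≤ T * jumpForm ν μ F F + (∫ ω, F ω ∂μ) ^ 2) ∧
    -- the log-Sobolev inequality fails for every constant
    (∀ C : ℝ, 0 < C → ∃ F ∈ jumpDomain ν μ, ∫ ω, F ω ^ 2 ∂μ = 1 ∧
      Integrable (fun ω => F ω ^ 2 * Real.log (F ω ^ 2)) μ ∧
      C * jumpForm ν μ F F < ∫ ω, F ω ^ 2 * Real.log (F ω ^ 2) ∂μ) := by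
  have hlaw := CadlagPath.law_eq_compoundPoissonLaw hT ν hX hμ
  have hq : JumpQuasiInvariant ν μ := by
    rw [hlaw]
    exact jumpQuasiInvariant_compoundPoissonLaw hT
  refine ⟨fun F F' G G' hF hG => ⟨jumpEnergy_congr hq hF, jumpForm_congr hq hF hG⟩,
    fun F hF G hG => ((mem_jumpDomain_iff hT).1 hF).integrable_mul ((mem_jumpDomain_iff hT).1 hG),
    isSymmetricDirichletForm_jumpForm hT hq, isConservative_jumpForm hT hq,
    fun F hF => jumpForm_poincare hT hlaw hF,
    fun C hC => exists_jumpForm_lt_entropy hT hν hX hμ hq hC⟩
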